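/- Let $(M,g)$ be a smooth Riemannian manifold of dimension $n$ (Hausdorff, second countable, without boundary), with Riemannian volume measure $\mathrm{Vol}_M$, given by $\sqrt{\det g}\,dx^1\cdots dx^n$ in every chart, and let $q\ge 1$. Tensor fields are called $L^1_{loc}$ if their coefficients in every smooth chart are locally integrable on the image of the chart, and covariant $k$-tensors carry the inner product $g(S,T)=g^{i_1j_1}\cdots g^{i_kj_k}S_{i_1\dots i_k}T_{j_1\dots j_k}$ (repeated indices are summed). Let $\nabla$ be the Levi-Civita connection, with Christoffel symbols $\Gamma^l_{ij}=\tfrac12 g^{lm}(\partial_i g_{jm}+\partial_j g_{im}-\partial_m g_{ij})$, and for a smooth covariant $(q+1)$-tensor field $\theta$ put $(\nabla^*\theta)_{i_1\dots i_q}=-g^{ij}\nabla_j\theta_{i\,i_1\dots i_q}$. Let $\alpha$ be an $L^1_{loc}$ $q$-form on $M$, and let the $L^1_{loc}$ covariant $(q+1)$-tensor field $\tau$ be a weak covariant derivative of $\alpha$, that is, $$\int_M g(\tau,\theta)\,\mathrm{Vol}_M=\int_M g(\alpha,\nabla^*\theta)\,\mathrm{Vol}_M$$ for every smooth compactly supported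 covariant $(q+1)$-tensor field $\theta$ on $M$. Then for every smooth chart $(\phi,\Omega)$ of $M$ and all indices $i,i_1,\dots,i_q\in\{1,\dots,n\}$ the coefficient $\alpha_{i_1\dots i_q}\circ\phi^{-1}$ has a weak partial derivative in the $i$-th direction on the open set $\phi(\Omega)\subseteq\mathbb R^n$: there is $w\in L^1_{loc}(\phi(\Omega))$ with $\int_{\phi(\Omega)}w\,\psi\,dx=-\int_{\phi(\Omega)}(\alpha_{i_1\dots i_q}\circ\phi^{-1})\,\partial_i\psi\,dx$ for all $\psi\in C^\infty_c(\phi(\Omega))$. Moreover, writing $\partial_i\alpha_{i_1\dots i_q}$ for this weak derivative (any such $w$), $$\tau_{i\,i_1\dots i_q}=\partial_i\alpha_{i_1\dots i_q}-\sum_{\mu=1}^q\Gamma^l_{i i_\mu}\,\alpha_{i_1\dots i_{\mu-1}\,l\,i_{\mu+1}\dots i_q}$$ almost everywhere on $\phi(\Omega)$, where $\tau$, $\Gamma$ and $\alpha$ are expressed in the coordinates of $\phi$. -/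

import Mathlib

open MeasureTheory
open scoped Manifold ContDiff Bundle

noncomputable section

namespace WeakCov

section Euclidean

variable {n : ℕ}

/-- The Euclidean partial derivative `∂ᵢ f`. -/
def pderiv (i : Fin n) (f : EuclideanSpace ℝ (Fin n) → ℝ) (y : EuclideanSpace ℝ (Fin n)) : ℝ :=
  fderiv ℝ f y (EuclideanSpace.single i 1)

/-- `w` is a weak `i`-th partial derivative of `u` on the open set `U ⊆ ℝⁿ`: both functions are
`L¹_loc` on `U`, and `∫_U w ψ dx = -∫_U u ∂ᵢψ dx` for all `ψ ∈ C^∞_c(U)`. -/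
structure IsWeakPartialDeriv (U : Set (EuclideanSpace ℝ (Fin n))) (i : Fin n)
    (u w : EuclideanSpace ℝ (Fin n) → ℝ) : Prop where
  locInt_fun : LocallyIntegrableOn u U volume
  locInt_deriv : LocallyIntegrableOn w U volume
  integral_eq : ∀ ψ : EuclideanSpace ℝ (Fin n) → ℝ,
    ContDiff ℝ ∞ ψ → HasCompactSupport ψ → tsupport ψ ⊆ U →
      ∫ y in U, w y * ψ y = -∫ y in U, u y * pderiv i ψ y

end Euclidean

section Manifold

variable {n : ℕ} {M : Type*} [TopologicalSpace M] [ChartedSpace (EuclideanSpace ℝ (Fin n)) M]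

variable (n M) in
/-- Covariant `k`-tensor fields on `M` (no regularity imposed). -/
abbrev TensorField (k : ℕ) : Type _ :=
  (x : M) → MultilinearMap ℝ (fun _ : Fin k => TangentSpace (𝓡 n) x) ℝ

variable (n M) in
/-- Differential `q`-forms on `M` (no regularity imposed). -/
abbrev Form (q : ℕ) : Type _ :=
  (x : M) → TangentSpace (𝓡 n) x [⋀^Fin q]→ₗ[ℝ] ℝ

/-- A `q`-form regarded as a covariant `q`-tensor field. -/
def Form.toTensor {q : ℕ} (α : Form n M q) : TensorField n M q :=
  fun x => (α x).toMultilinearMap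

/-- The coordinate vector `∂/∂xⁱ` of the chart `e`, at the point with coordinates `y`. -/
def coordVec (e : OpenPartialHomeomorph M (EuclideanSpace ℝ (Fin n)))
    (y : EuclideanSpace ℝ (Fin n)) (i : Fin n) : TangentSpace (𝓡 n) (e.symm y) :=
  mfderiv (𝓡 n) (𝓡 n) e.symm y
    (EuclideanSpace.single i (1 : ℝ) : EuclideanSpace ℝ (Fin n))

/-- The coordinate covector `dxⁱ` of the chart `e`, at the point `x` of the manifold. -/
def coordCovec (e : OpenPartialHomeomorph M (EuclideanSpace ℝ (Fin n))) (x : M) (i : Fin n) :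
    TangentSpace (𝓡 n) x →ₗ[ℝ] ℝ :=
  (EuclideanSpace.proj (𝕜 := ℝ) i : EuclideanSpace ℝ (Fin n) →L[ℝ] ℝ).toLinearMap ∘ₗ
    (mfderiv (𝓡 n) (𝓡 n) e x).toLinearMap

/-- The coefficient `T_{J₁…J_k} ∘ e⁻¹` of a covariant tensor field in the chart `e`, as a function
of the coordinates (meaningful on `e.target`). -/
def coeff {k : ℕ} (e : OpenPartialHomeomorph M (EuclideanSpace ℝ (Fin n)))
    (T : TensorField n M k) (J : Fin k → Fin n) (y : EuclideanSpace ℝ (Fin n)) : ℝ :=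
  T (e.symm y) (fun m => coordVec e y (J m))

/-- The covariant `k`-tensor `∑_J c_J dx^{J₁} ⊗ ⋯ ⊗ dx^{J_k}` at `x`, in the chart `e`. -/
def tensorOfCoeffs {k : ℕ} (e : OpenPartialHomeomorph M (EuclideanSpace ℝ (Fin n))) (x : M)
    (c : (Fin k → Fin n) → ℝ) :
    MultilinearMap ℝ (fun _ : Fin k => TangentSpace (𝓡 n) x) ℝ :=
  ∑ J : Fin k → Fin n,
    c J • (MultilinearMap.mkPiAlgebra ℝ (Fin k) ℝ).compLinearMap (fun m => coordCovec e x (J m))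

/-- A tensor field is `L¹_loc` when all its coefficients, in all charts of the smooth structure,
are locally integrable functions (in particular a.e. measurable) on the image of the chart. -/
def LocInt [IsManifold (𝓡 n) ∞ M] {k : ℕ} (T : TensorField n M k) : Prop :=
  ∀ e ∈ IsManifold.maximalAtlas (𝓡 n) ∞ M, ∀ J : Fin k → Fin n,
    LocallyIntegrableOn (coeff e T J) e.target volume

/-- A tensor field is smooth when all its coefficients, in all charts of the smooth structure, are
smooth functions on the image of the chart. -/
def Smooth [IsManifold (𝓡 n) ∞ M] {k : ℕ} (T : TensorField n M k) : Prop :=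
  ∀ e ∈ IsManifold.maximalAtlas (𝓡 n) ∞ M, ∀ J : Fin k → Fin n,
    ContDiffOn ℝ ∞ (coeff e T J) e.target

/-- The support of the tensor field, `closure {x | T x ≠ 0}`, is compact. -/
def CompactlySupported {k : ℕ} (T : TensorField n M k) : Prop :=
  IsCompact (closure {x : M | T x ≠ 0})

variable [IsManifold (𝓡 n) ∞ M]

variable (n M) in
/-- Smooth Riemannian metrics on `M`. -/
abbrev Metric : Type _ :=
  Bundle.ContMDiffRiemannianMetric (𝓡 n) ∞ (EuclideanSpace ℝ (Fin n))
    (fun x : M => TangentSpace (𝓡 n) x)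

/-- The matrix `(g_{ij})` in the chart `e`, as a function of the coordinates. -/
def gram (g : Metric n M) (e : OpenPartialHomeomorph M (EuclideanSpace ℝ (Fin n)))
    (y : EuclideanSpace ℝ (Fin n)) : Matrix (Fin n) (Fin n) ℝ :=
  Matrix.of fun i j => g.inner (e.symm y) (coordVec e y i) (coordVec e y j)

/-- The Christoffel symbol `Γ^l_{ij} = ½ g^{lm} (∂ᵢ g_{jm} + ∂ⱼ g_{im} - ∂ₘ g_{ij})` of the
Levi-Civita connection in the chart `e`. -/
def christoffel (g : Metric n M) (e : OpenPartialHomeomorph M (EuclideanSpace ℝ (Fin n)))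
    (l i j : Fin n) (y : EuclideanSpace ℝ (Fin n)) : ℝ :=
  (1 / 2 : ℝ) * ∑ m : Fin n, (gram g e y)⁻¹ l m *
    (pderiv i (fun z => gram g e z j m) y + pderiv j (fun z => gram g e z i m) y
      - pderiv m (fun z => gram g e z i j) y)

/-- The components of the (classical) covariant derivative in the chart `e`:
`∇ᵢ T_{J₁…J_k} = ∂ᵢ T_{J₁…J_k} - ∑_μ Γ^l_{i J_μ} T_{J₁…l…J_k}`, with `l` in the `μ`-th place. -/
def covDerivCoeff {k : ℕ} (g : Metric n M)
    (e : OpenPartialHomeomorph M (EuclideanSpace ℝ (Fin n))) (T : TensorField n M k)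
    (i : Fin n) (J : Fin k → Fin n) (y : EuclideanSpace ℝ (Fin n)) : ℝ :=
  pderiv i (coeff e T J) y -
    ∑ μ : Fin k, ∑ l : Fin n,
      christoffel g e l i (J μ) y * coeff e T (Function.update J μ l) y

/-- The components of the adjoint `∇*θ` of the covariant derivative, in the chart `e`:
`(∇*θ)_J = -∇^i θ_{iJ} = -g^{ij} ∇ⱼ θ_{iJ}`. -/
def covAdjointCoeff {k : ℕ} (g : Metric n M)
    (e : OpenPartialHomeomorph M (EuclideanSpace ℝ (Fin n))) (θ : TensorField n M (k + 1))
    (J : Fin k → Fin n) (y : EuclideanSpace ℝ (Fin n)) : ℝ :=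
  -∑ i : Fin n, ∑ j : Fin n,
    (gram g e y)⁻¹ i j * covDerivCoeff g e θ j (Fin.cons i J) y

/-- The adjoint `∇*θ`, a covariant `k`-tensor field on `M`. Its value at `x` is written down in the
preferred chart at `x`; for smooth `θ` any other chart around `x` gives the same tensor. -/
def covAdjoint {k : ℕ} (g : Metric n M) (θ : TensorField n M (k + 1)) : TensorField n M k :=
  fun x =>
    tensorOfCoeffs (chartAt (EuclideanSpace ℝ (Fin n)) x) x fun J =>
      covAdjointCoeff g (chartAt (EuclideanSpace ℝ (Fin n)) x) θ J
        (chartAt (EuclideanSpace ℝ (Fin n)) x x)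

/-- The pointwise inner product of covariant tensors in the chart `e`:
`g(S, T) = g^{I₁J₁} ⋯ g^{I_kJ_k} S_{I₁…I_k} T_{J₁…J_k}`. -/
def tensorInnerCoord {k : ℕ} (g : Metric n M)
    (e : OpenPartialHomeomorph M (EuclideanSpace ℝ (Fin n))) (S T : TensorField n M k)
    (y : EuclideanSpace ℝ (Fin n)) : ℝ :=
  ∑ I : Fin k → Fin n, ∑ J : Fin k → Fin n,
    (∏ m : Fin k, (gram g e y)⁻¹ (I m) (J m)) * coeff e S I y * coeff e T J y

/-- The function `g(S, T)` on `M`. Its value at `x` is computed in the preferred chart at `x`; any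
other chart around `x` gives the same number. -/
def tensorInner {k : ℕ} (g : Metric n M) (S T : TensorField n M k) (x : M) : ℝ :=
  tensorInnerCoord g (chartAt (EuclideanSpace ℝ (Fin n)) x) S T
    (chartAt (EuclideanSpace ℝ (Fin n)) x x)

/-- The Riemannian volume on the domain of the chart `e`, that is the measure
`√(det g) dx¹ ⋯ dxⁿ`, regarded as a measure on `M` carried by `e.source`. -/
def chartVolume [MeasurableSpace M] (g : Metric n M)
    (e : OpenPartialHomeomorph M (EuclideanSpace ℝ (Fin n))) : Measure M :=
  Measure.map e.symm
    ((volume.restrict e.target).withDensity fun y => ENNReal.ofReal (√(gram g e y).det))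

/-- The Riemannian volume measure `Vol_M`: the least measure on `M` that dominates
`√(det g) dx¹ ⋯ dxⁿ` in every chart of the smooth structure. Since these local measures agree on
the overlaps of charts, it restricts to `chartVolume g e` on the domain of every chart `e`. -/
def riemannianVolume [MeasurableSpace M] (g : Metric n M) : Measure M :=
  ⨆ e ∈ IsManifold.maximalAtlas (𝓡 n) ∞ M, chartVolume g e

/-- The covariant `(q+1)`-tensor field `τ` is a weak covariant derivative of the `q`-form `α`: both
are `L¹_loc`, and `∫_M g(τ, θ) Vol_M = ∫_M g(α, ∇*θ) Vol_M` for every smooth compactly supported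
covariant `(q+1)`-tensor field `θ`. The first slot of `τ` is the direction of differentiation. -/
structure IsWeakCovDeriv [MeasurableSpace M] {q : ℕ} (g : Metric n M) (α : Form n M q)
    (τ : TensorField n M (q + 1)) : Prop where
  locInt_form : LocInt α.toTensor
  locInt_deriv : LocInt τ
  integral_eq : ∀ θ : TensorField n M (q + 1), Smooth θ → CompactlySupported θ →
    ∫ x, tensorInner g τ θ x ∂(riemannianVolume g) =
      ∫ x, tensorInner g α.toTensor (covAdjoint g θ) x ∂(riemannianVolume g)

end Manifold

end WeakCov

end

/-! Fix a chart, an index `i` and a multi-index `J`, and let `ψ` be a test function on the image of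
the chart. The weak identity is tested against the tensor `θ` obtained from `(ψ/√det g) ∂_i ⊗ ∂_{J₁}
⊗ ⋯ ⊗ ∂_{J_q}` by lowering all indices, extended by zero. Raising undoes lowering, so `√det g · g(τ,
θ) = τ_{iJ} ψ` (`density_mul_tensorInner_testTensor`).

On the other side the connection is metric, so `∇` only sees the scalar factor and the coordinate
fields (`covDerivOf_kronPow`). Contracting gives the divergence of `∂_i`, namely `Γ^l_{il}`,
together with the terms `Γ^l_{i J_μ}`. Since `∂_i √det g = √det g Γ^l_{il}` (`pderiv_sqrt_det`), the
divergence is exactly what the factor `1/√det g` absorbs, and `√det g · g(α, ∇*θ) = -(α_J ∂_i ψ + Σ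
Γ^l_{i J_μ} α_{J[μ→l]} ψ)`. Thus `τ_{iJ} + Σ Γ α` is a weak `i`-th derivative of `α_J`, and a.e.
uniqueness of weak derivatives gives the formula for any other choice.

The remaining work is coordinate invariance. The inner product and `∇*θ` are defined pointwise in
preferred charts, and the volume is a supremum over charts; the transformation laws of `g`, `Γ` and
`∇` (`sum_jac_christoffel`, `covDerivOf_transform`) and the change of variables formula turn all
three into the classical expressions in the given chart. -/

noncomputable section

namespace WeakCov

/-! ### Multi-index algebra: Kronecker powers of a matrix -/

section KroneckerPower

variable {ι : Type*} {k : ℕ}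

/-- The `k`-fold Kronecker power of a matrix, indexed by multi-indices. -/
def kronPow (k : ℕ) (B : Matrix ι ι ℝ) : Matrix (Fin k → ι) (Fin k → ι) ℝ :=
  Matrix.of fun I J => ∏ m, B (I m) (J m)

lemma kronPow_apply (B : Matrix ι ι ℝ) (I J : Fin k → ι) :
    kronPow k B I J = ∏ m, B (I m) (J m) := rfl

lemma kronPow_mul [Fintype ι] (B C : Matrix ι ι ℝ) :
    kronPow k (B * C) = kronPow k B * kronPow k C := by
  ext I J
  simp [kronPow, Matrix.mul_apply, Fintype.prod_sum, Finset.prod_mul_distrib]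

lemma kronPow_one [DecidableEq ι] : kronPow k (1 : Matrix ι ι ℝ) = 1 := by
  ext I J
  rw [kronPow_apply, Matrix.one_apply]
  split_ifs with h
  · subst h; simp
  · obtain ⟨m, hm⟩ := Function.ne_iff.1 h
    exact Finset.prod_eq_zero (Finset.mem_univ m) (Matrix.one_apply_ne hm)

lemma kronPow_transpose (B : Matrix ι ι ℝ) :
    kronPow k B.transpose = (kronPow k B).transpose := rfl

lemma kronPow_cons (B : Matrix ι ι ℝ) (a b : ι) (I J : Fin k → ι) :
    kronPow (k + 1) B (Fin.cons a I : Fin (k + 1) → ι) (Fin.cons b J : Fin (k + 1) → ι) =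
      B a b * kronPow k B I J := by
  simp [kronPow_apply, Fin.prod_univ_succ]

lemma kronPow_update_right (B : Matrix ι ι ℝ) (I J : Fin k → ι) (μ : Fin k) (l : ι) :
    kronPow k B I (Function.update J μ l) =
      (∏ m ∈ Finset.univ.erase μ, B (I m) (J m)) * B (I μ) l := by
  rw [kronPow_apply, ← Finset.prod_erase_mul _ _ (Finset.mem_univ μ), Function.update_self]
  congr 1
  refine Finset.prod_congr rfl fun m hm => ?_
  rw [Function.update_of_ne (Finset.ne_of_mem_erase hm)]

lemma kronPow_update_left (B : Matrix ι ι ℝ) (I J : Fin k → ι) (μ : Fin k) (l : ι) :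
    kronPow k B (Function.update I μ l) J =
      (∏ m ∈ Finset.univ.erase μ, B (I m) (J m)) * B l (J μ) :=
  kronPow_update_right B.transpose J I μ l

/-- Exchanging the `μ`-th entry of `K` with `l` is an involution on pairs `(K, l)`. This renames
dummy indices when a Christoffel symbol acts on the `μ`-th slot. -/
lemma sum_sum_update_swap [Fintype ι] (μ : Fin k) (Φ : (Fin k → ι) → ι → ℝ) :
    ∑ K, ∑ l, Φ K l = ∑ K, ∑ l, Φ (Function.update K μ l) (K μ) := by
  rw [← Fintype.sum_prod_type', ← Fintype.sum_prod_type']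
  refine Fintype.sum_equiv
    { toFun := fun p => (Function.update p.1 μ p.2, p.1 μ)
      invFun := fun p => (Function.update p.1 μ p.2, p.1 μ)
      left_inv := fun p => by simp
      right_inv := fun p => by simp } _ _ fun p => by simp

lemma sum_cons [Fintype ι] (Φ : (Fin (k + 1) → ι) → ℝ) :
    ∑ P, Φ P = ∑ a, ∑ K : Fin k → ι, Φ (Fin.cons a K) := by
  rw [← Fintype.sum_prod_type']
  exact (Fintype.sum_equiv (Fin.consEquiv fun _ => ι) _ _ fun p => rfl).symm

end KroneckerPower

/-! ### Partial derivatives and Jacobian matrices -/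

section Calculus

variable {n : ℕ}

local notation "E" => EuclideanSpace ℝ (Fin n)

lemma pderiv_congr {i : Fin n} {f h : E → ℝ} {y : E} (H : f =ᶠ[nhds y] h) :
    pderiv i f y = pderiv i h y := by
  rw [pderiv, H.fderiv_eq, pderiv]

lemma pderiv_mul {i : Fin n} {f h : E → ℝ} {y : E} (hf : DifferentiableAt ℝ f y)
    (hh : DifferentiableAt ℝ h y) :
    pderiv i (fun z => f z * h z) y = pderiv i f y * h y + f y * pderiv i h y := by
  simp only [pderiv]
  rw [fderiv_fun_mul hf hh]
  simp; ring

lemma pderiv_sum {κ : Type*} {s : Finset κ} {i : Fin n} {f : κ → E → ℝ} {y : E}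
    (hf : ∀ a ∈ s, DifferentiableAt ℝ (f a) y) :
    pderiv i (fun z => ∑ a ∈ s, f a z) y = ∑ a ∈ s, pderiv i (f a) y := by
  simp only [pderiv]
  rw [fderiv_fun_sum hf]
  simp

lemma pderiv_prod {κ : Type*} [DecidableEq κ] {s : Finset κ} {i : Fin n} {f : κ → E → ℝ} {y : E}
    (hf : ∀ a ∈ s, DifferentiableAt ℝ (f a) y) :
    pderiv i (fun z => ∏ a ∈ s, f a z) y =
      ∑ a ∈ s, (∏ b ∈ s.erase a, f b y) * pderiv i (f a) y := by
  simp only [pderiv]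
  rw [(HasFDerivAt.finsetProd fun a ha => (hf a ha).hasFDerivAt).fderiv]
  simp

/-- The Jacobian matrix of a map between Euclidean spaces. -/
def jac (F : E → E) (y : E) : Matrix (Fin n) (Fin n) ℝ :=
  Matrix.of fun a i => fderiv ℝ F y (EuclideanSpace.single i 1) a

lemma jac_eq_toMatrix (F : E → E) (y : E) :
    jac F y = LinearMap.toMatrix (EuclideanSpace.basisFun (Fin n) ℝ).toBasis
      (EuclideanSpace.basisFun (Fin n) ℝ).toBasis (fderiv ℝ F y).toLinearMap := by
  ext a i
  simp [jac, LinearMap.toMatrix_apply]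

lemma det_jac (F : E → E) (y : E) : (jac F y).det = (fderiv ℝ F y).det := by
  rw [jac_eq_toMatrix, LinearMap.det_toMatrix]

lemma sum_smul_single (v : E) : v = ∑ a, v a • EuclideanSpace.single a (1 : ℝ) := by
  ext b
  simp [Finset.sum_apply, Pi.single_apply]

lemma pderiv_comp {i : Fin n} {F : E → E} {u : E → ℝ} {y : E} (hF : DifferentiableAt ℝ F y)
    (hu : DifferentiableAt ℝ u (F y)) :
    pderiv i (fun z => u (F z)) y = ∑ c, jac F y c i * pderiv c u (F y) := by
  have : fderiv ℝ (fun z => u (F z)) y = (fderiv ℝ u (F y)).comp (fderiv ℝ F y) :=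
    fderiv_comp y hu hF
  rw [pderiv, this, ContinuousLinearMap.comp_apply,
    sum_smul_single (fderiv ℝ F y (EuclideanSpace.single i 1)), map_sum]
  simp [jac, pderiv]

lemma contDiffAt_fderiv_apply {F : E → E} {y : E} (hF : ContDiffAt ℝ ∞ F y) (v : E) (a : Fin n) :
    ContDiffAt ℝ ∞ (fun z => fderiv ℝ F z v a) y := by
  have h1 : ContDiffAt ℝ ∞ (fderiv ℝ F) y := hF.fderiv_right (by simp)
  have h2 : ContDiffAt ℝ ∞ (fun z => fderiv ℝ F z v) y := h1.clm_apply contDiffAt_const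
  exact (EuclideanSpace.proj (𝕜 := ℝ) a : E →L[ℝ] ℝ).contDiff.contDiffAt.comp y h2

lemma contDiffAt_jac {F : E → E} {y : E} (hF : ContDiffAt ℝ ∞ F y) (a i : Fin n) :
    ContDiffAt ℝ ∞ (fun z => jac F z a i) y :=
  contDiffAt_fderiv_apply hF _ a

/-- Symmetry of the second derivative of `F`. It produces the cancellations in the transformation
law of the Christoffel symbols. -/
lemma pderiv_jac_symm {F : E → E} {y : E} (hF : ContDiffAt ℝ ∞ F y) (a i j : Fin n) :
    pderiv i (fun z => jac F z a j) y = pderiv j (fun z => jac F z a i) y := by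
  have hd : DifferentiableAt ℝ (fderiv ℝ F) y :=
    ((hF.fderiv_right (m := ∞) (by simp)).differentiableAt (by simp))
  have key : ∀ v w : E, fderiv ℝ (fun z => fderiv ℝ F z w a) y v = fderiv ℝ (fderiv ℝ F) y v w a := by
    intro v w
    have h := (((EuclideanSpace.proj (𝕜 := ℝ) a : E →L[ℝ] ℝ).comp
      (ContinuousLinearMap.apply ℝ E w)).hasFDerivAt.comp y hd.hasFDerivAt)
    have h' : HasFDerivAt (fun z => fderiv ℝ F z w a) _ y := h
    rw [h'.fderiv]
    rfl
  have hs : IsSymmSndFDerivAt ℝ F y := hF.isSymmSndFDerivAt (by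
    rw [minSmoothness_of_isRCLikeNormedField]
    exact WithTop.coe_le_coe.2 (le_top : (2 : ℕ∞) ≤ ⊤))
  simp only [pderiv, jac, Matrix.of_apply]
  rw [key, key, hs]

lemma jac_congr {F F' : E → E} {y : E} (h : F =ᶠ[nhds y] F') : jac F y = jac F' y := by
  ext a i
  simp only [jac, h.fderiv_eq]

lemma jac_self {M : Type*} [TopologicalSpace M] {c : OpenPartialHomeomorph M E} {y : E}
    (hy : y ∈ c.target) : jac (c ∘ c.symm) y = 1 := by
  have h : c ∘ c.symm =ᶠ[nhds y] id := by
    filter_upwards [c.open_target.mem_nhds hy] with z hz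
    exact c.right_inv hz
  rw [jac_congr h]
  ext a i
  simp [jac, Matrix.one_apply]

lemma eventually_mem_target {M : Type*} [TopologicalSpace M] {e c : OpenPartialHomeomorph M E}
    {y : E} (hy : y ∈ e.target) (hyc : e.symm y ∈ c.source) : ∀ᶠ z in nhds y, z ∈ e.target ∧ e.symm z ∈ c.source :=
  Filter.Eventually.and (e.open_target.mem_nhds hy)
    ((e.continuousAt_symm hy).preimage_mem_nhds (c.open_source.mem_nhds hyc))

lemma isCompact_image_tsupport {M : Type*} [TopologicalSpace M]
    {c : OpenPartialHomeomorph M E} {ψ : E → ℝ} (hs : HasCompactSupport ψ)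
    (hU : tsupport ψ ⊆ c.target) : IsCompact (c.symm '' tsupport ψ) :=
  hs.isCompact.image_of_continuousOn (c.continuousOn_symm.mono hU)

end Calculus

/-! ### Christoffel symbols: symmetry, metric compatibility, transformation law -/

section LeviCivita

variable {n k : ℕ}

local notation "E" => EuclideanSpace ℝ (Fin n)
local notation "Mat" => Matrix (Fin n) (Fin n) ℝ

/-- The Christoffel symbols of a metric on a subset of Euclidean space, given by its matrix. -/
def christoffelOf (G : E → Mat) (l i j : Fin n) (y : E) : ℝ :=
  (1 / 2 : ℝ) * ∑ m : Fin n, (G y)⁻¹ l m *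
    (pderiv i (fun z => G z j m) y + pderiv j (fun z => G z i m) y
      - pderiv m (fun z => G z i j) y)

/-- The Christoffel symbols with the upper index lowered. -/
def christoffelLow (G : E → Mat) (s i j : Fin n) (y : E) : ℝ :=
  (1 / 2 : ℝ) * (pderiv i (fun z => G z j s) y + pderiv j (fun z => G z i s) y
      - pderiv s (fun z => G z i j) y)

/-- The covariant derivative of a tensor field given by its coefficients. -/
def covDerivOf (G : E → Mat) (t : (Fin k → Fin n) → E → ℝ) (i : Fin n) (J : Fin k → Fin n)
    (y : E) : ℝ :=
  pderiv i (t J) y -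
    ∑ μ : Fin k, ∑ l : Fin n, christoffelOf G l i (J μ) y * t (Function.update J μ l) y

/-- The adjoint of the covariant derivative, in terms of coefficients. -/
def covAdjointOf (G : E → Mat) (t : (Fin (k + 1) → Fin n) → E → ℝ) (J : Fin k → Fin n)
    (y : E) : ℝ :=
  -∑ i : Fin n, ∑ j : Fin n, (G y)⁻¹ i j * covDerivOf G t j (Fin.cons i J) y

lemma sum_mul_christoffelOf {G : E → Mat} {y : E} (hdet : IsUnit (G y).det) (s i j : Fin n) :
    ∑ l, G y s l * christoffelOf G l i j y = christoffelLow G s i j y := by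
  set D : Fin n → ℝ := fun m => (1 / 2 : ℝ) *
    (pderiv i (fun z => G z j m) y + pderiv j (fun z => G z i m) y
      - pderiv m (fun z => G z i j) y) with hD
  have h1 : ∀ l, christoffelOf G l i j y = ((G y)⁻¹.mulVec D) l := by
    intro l
    simp only [christoffelOf, Matrix.mulVec, dotProduct, hD, Finset.mul_sum]
    exact Finset.sum_congr rfl fun m _ => by ring
  simp only [h1]
  change ((G y).mulVec ((G y)⁻¹.mulVec D)) s = D s
  rw [Matrix.mulVec_mulVec, Matrix.mul_nonsing_inv _ hdet, Matrix.one_mulVec]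

lemma christoffelOf_symm {G : E → Mat} (hG : ∀ z, (G z).IsSymm) (l i j : Fin n) (y : E) :
    christoffelOf G l i j y = christoffelOf G l j i y := by
  have h : (fun z => G z i j) = fun z => G z j i := funext fun z => (hG z).apply j i
  simp only [christoffelOf, h]
  congr 1
  exact Finset.sum_congr rfl fun m _ => by ring

/-- Metric compatibility of the Levi-Civita connection. -/
lemma pderiv_metric {G : E → Mat} (hG : ∀ z, (G z).IsSymm) {y : E} (hdet : IsUnit (G y).det)
    (b s t : Fin n) :
    pderiv b (fun z => G z s t) y =
      ∑ l, christoffelOf G l b s y * G y l t + ∑ l, christoffelOf G l b t y * G y s l := by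
  have hsymm : ∀ i j, (fun z => G z i j) = fun z => G z j i :=
    fun i j => funext fun z => (hG z).apply j i
  have h1 := sum_mul_christoffelOf hdet t b s
  have h2 := sum_mul_christoffelOf hdet s b t
  have h3 : ∑ l, christoffelOf G l b s y * G y l t = christoffelLow G t b s y := by
    rw [← h1]
    exact Finset.sum_congr rfl fun l _ => by rw [(hG y).apply t l, mul_comm]
  have h4 : ∑ l, christoffelOf G l b t y * G y s l = christoffelLow G s b t y := by
    rw [← h2]
    exact Finset.sum_congr rfl fun l _ => mul_comm _ _
  -- In the sum of the two lowered symbols the derivatives in the directions `s` and `t` cancel,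
  -- leaving two halves of the `b`-derivative.
  rw [h3, h4, christoffelLow, christoffelLow, hsymm t s]
  ring

/-- The transformation law of the Christoffel symbols. -/
lemma sum_jac_christoffel {G G' : E → Mat} {F : E → E} {y : E} (hG : ∀ z, (G z).IsSymm)
    (hF : ContDiffAt ℝ ∞ F y) (hGd : ∀ a b, DifferentiableAt ℝ (fun z => G z a b) (F y))
    (hGG' : ∀ᶠ z in nhds y, G' z = (jac F z).transpose * G (F z) * jac F z)
    (hdet : IsUnit (G (F y)).det) (hdet' : IsUnit (jac F y).det) (d i j : Fin n) :
    ∑ l, jac F y d l * christoffelOf G' l i j y =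
      ∑ a, ∑ b, christoffelOf G d a b (F y) * jac F y a i * jac F y b j
        + pderiv i (fun z => jac F z d j) y := by
  have hFd : DifferentiableAt ℝ F y := hF.differentiableAt (by simp)
  set A := jac F y with hA
  have hAd : ∀ a i, DifferentiableAt ℝ (fun z => jac F z a i) y :=
    fun a i => (contDiffAt_jac hF a i).differentiableAt (by simp)
  have hGFd : ∀ a b, DifferentiableAt ℝ (fun z => G (F z) a b) y :=
    fun a b => (hGd a b).comp y hFd
  have hG'y : G' y = A.transpose * G (F y) * A := hGG'.self_of_nhds
  have hdetG' : IsUnit (G' y).det := by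
    rw [hG'y, Matrix.det_mul, Matrix.det_mul, Matrix.det_transpose]
    exact (hdet'.mul hdet).mul hdet'
  let H : Fin n → Fin n → Fin n → ℝ := fun a p r => pderiv p (fun z => jac F z a r) y
  have hH : ∀ a p r, H a p r = H a r p := fun a p r => pderiv_jac_symm hF a p r
  let D : Fin n → Fin n → Fin n → ℝ := fun c a b => pderiv c (fun z => G z a b) (F y)
  have hDsymm : ∀ c a b, D c a b = D c b a := by
    intro c a b
    have : (fun z => G z a b) = fun z => G z b a := funext fun z => (hG z).apply b a
    simp only [D, this]
  -- The product rule for `AᵀGA` gives terms where the derivative falls on a Jacobian (`Q`) and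
  -- terms where it falls on `G` (`S`).
  let Q : Fin n → Fin n → Fin n → ℝ := fun p r s => ∑ a, ∑ b, H a p r * A b s * G (F y) a b
  let S : Fin n → Fin n → Fin n → ℝ := fun p r s =>
    ∑ a, ∑ b, ∑ c, A a r * A b s * A c p * D c a b
  have hQ : ∀ p r s, Q p r s = Q r p s := by
    intro p r s
    simp only [Q, hH _ p r]
  have hder : ∀ p r s, pderiv p (fun z => G' z r s) y = Q p r s + Q p s r + S p r s := by
    intro p r s
    have e1 : (fun z => G' z r s) =ᶠ[nhds y]
        fun z => ∑ a, ∑ b, jac F z a r * jac F z b s * G (F z) a b := by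
      filter_upwards [hGG'] with z hz
      rw [hz]
      simp only [Matrix.mul_apply, Matrix.transpose_apply, Finset.sum_mul]
      rw [Finset.sum_comm]
      exact Finset.sum_congr rfl fun a _ => Finset.sum_congr rfl fun b _ => by ring
    have e2 : Q p s r = ∑ a, ∑ b, A a r * H b p s * G (F y) a b := by
      simp only [Q]
      rw [Finset.sum_comm]
      refine Finset.sum_congr rfl fun a _ => Finset.sum_congr rfl fun b _ => ?_
      rw [(hG (F y)).apply a b]; ring
    rw [pderiv_congr e1, pderiv_sum (fun a _ => DifferentiableAt.fun_sum fun b _ =>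
      ((hAd a r).fun_mul (hAd b s)).fun_mul (hGFd a b)), e2]
    simp only [Q, S, ← Finset.sum_add_distrib]
    refine Finset.sum_congr rfl fun a _ => ?_
    rw [pderiv_sum (fun b _ => ((hAd a r).fun_mul (hAd b s)).fun_mul (hGFd a b))]
    refine Finset.sum_congr rfl fun b _ => ?_
    rw [pderiv_mul ((hAd a r).fun_mul (hAd b s)) (hGFd a b), pderiv_mul (hAd a r) (hAd b s),
      pderiv_comp (u := fun z => G z a b) hFd (hGd a b), Finset.mul_sum, add_mul]
    simp only [H, D, A, mul_assoc]
  -- Of the six `Q` terms in the lowered symbol, symmetry in the first two arguments cancels four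
  -- and merges the other two.
  have hlow : ∀ s, christoffelLow G' s i j y =
      Q i j s + (1 / 2) * (S i j s + S j i s - S s i j) := by
    intro s
    rw [christoffelLow, hder, hder, hder, hQ j i s, hQ i s j, hQ j s i]
    ring
  have hSl : ∀ s, (1 / 2) * (S i j s + S j i s - S s i j) =
      ∑ e, A e s * ∑ a, ∑ b, christoffelLow G e a b (F y) * A a i * A b j := by
    intro s
    have r1 : S i j s = ∑ e, ∑ a, ∑ b, A e s * A a i * A b j * D a b e := by
      simp only [S]
      rw [Finset.sum_comm]
      refine Finset.sum_congr rfl fun e _ => ?_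
      rw [Finset.sum_comm]
      exact Finset.sum_congr rfl fun a _ => Finset.sum_congr rfl fun b _ => by ring
    have r2 : S j i s = ∑ e, ∑ a, ∑ b, A e s * A a i * A b j * D b a e := by
      simp only [S]
      rw [Finset.sum_comm]
      exact Finset.sum_congr rfl fun e _ => Finset.sum_congr rfl fun a _ =>
        Finset.sum_congr rfl fun b _ => by ring
    have r3 : S s i j = ∑ e, ∑ a, ∑ b, A e s * A a i * A b j * D e a b := by
      simp only [S]
      rw [Finset.sum_comm' (t' := Finset.univ) (s' := fun _ => Finset.univ) (by simp)]
      rw [Finset.sum_comm]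
      simp only [fun a : Fin n => Finset.sum_comm (s := Finset.univ) (t := Finset.univ)
        (f := fun b c => A a i * A b j * A c s * D c a b)]
      rw [Finset.sum_comm]
      exact Finset.sum_congr rfl fun e _ => Finset.sum_congr rfl fun a _ =>
        Finset.sum_congr rfl fun b _ => by ring
    rw [r1, r2, r3]
    simp only [← Finset.sum_add_distrib, ← Finset.sum_sub_distrib, Finset.mul_sum,
      christoffelLow]
    refine Finset.sum_congr rfl fun e _ => Finset.sum_congr rfl fun a _ =>
        Finset.sum_congr rfl fun b _ => ?_
    simp only [D]
    ring
  let L : Fin n → ℝ := fun d => ∑ l, A d l * christoffelOf G' l i j y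
  let R : Fin n → ℝ := fun d =>
    ∑ a, ∑ b, christoffelOf G d a b (F y) * A a i * A b j + H d i j
  -- Both sides are compared after applying the invertible matrix `AᵀG`. On the left this lowers the
  -- index with respect to `G' = AᵀGA`, so no inverse metric remains.
  have hunit : IsUnit (A.transpose * G (F y)) := by
    rw [Matrix.isUnit_iff_isUnit_det, Matrix.det_mul, Matrix.det_transpose]
    exact hdet'.mul hdet
  suffices h : (A.transpose * G (F y)).mulVec L = (A.transpose * G (F y)).mulVec R from
    congrFun (Matrix.mulVec_injective_of_isUnit hunit h) d
  ext s
  have hL : (A.transpose * G (F y)).mulVec L s = christoffelLow G' s i j y := by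
    rw [← sum_mul_christoffelOf hdetG']
    change (A.transpose * G (F y)).mulVec (A.mulVec fun l => christoffelOf G' l i j y) s = _
    rw [Matrix.mulVec_mulVec, ← hG'y]; rfl
  have hR : (G (F y)).mulVec R = fun e =>
      ∑ a, ∑ b, christoffelLow G e a b (F y) * A a i * A b j + ∑ d, G (F y) e d * H d i j := by
    ext e
    simp only [Matrix.mulVec, dotProduct, R, mul_add, Finset.sum_add_distrib]
    congr 1
    simp only [← sum_mul_christoffelOf hdet, Finset.mul_sum, Finset.sum_mul]
    rw [Finset.sum_comm]
    refine Finset.sum_congr rfl fun a _ => ?_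
    rw [Finset.sum_comm]
    exact Finset.sum_congr rfl fun b _ => Finset.sum_congr rfl fun d _ => by ring
  rw [hL, hlow, hSl, ← Matrix.mulVec_mulVec, hR]
  simp only [Matrix.mulVec, dotProduct, Matrix.transpose_apply, mul_add, Finset.sum_add_distrib]
  rw [add_comm]
  congr 1
  simp only [Q, Finset.mul_sum]
  rw [Finset.sum_comm]
  refine Finset.sum_congr rfl fun a _ => Finset.sum_congr rfl fun b _ => ?_
  rw [(hG (F y)).apply a b]; ring

end LeviCivita

/-! ### Tensoriality of the covariant derivative, its adjoint and the inner product -/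

section ChangeOfCoordinates

variable {n k : ℕ}

local notation "E" => EuclideanSpace ℝ (Fin n)
local notation "Mat" => Matrix (Fin n) (Fin n) ℝ

lemma differentiableAt_prod {κ : Type*} {s : Finset κ} {f : κ → E → ℝ} {y : E}
    (hf : ∀ a ∈ s, DifferentiableAt ℝ (f a) y) :
    DifferentiableAt ℝ (fun z => ∏ a ∈ s, f a z) y := by
  classical
  exact (HasFDerivAt.finsetProd fun a ha => (hf a ha).hasFDerivAt).differentiableAt

lemma pderiv_kronPow {B : E → Mat} {y : E} (hB : ∀ a b, DifferentiableAt ℝ (fun z => B z a b) y)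
    (i : Fin n) (K J : Fin k → Fin n) :
    pderiv i (fun z => kronPow k (B z) K J) y =
      ∑ μ, (∏ m ∈ Finset.univ.erase μ, B y (K m) (J m)) *
        pderiv i (fun z => B z (K μ) (J μ)) y :=
  pderiv_prod (s := Finset.univ) (f := fun m z => B z (K m) (J m)) fun m _ => hB (K m) (J m)

lemma differentiableAt_kronPow {B : E → Mat} {y : E}
    (hB : ∀ a b, DifferentiableAt ℝ (fun z => B z a b) y) (K J : Fin k → Fin n) :
    DifferentiableAt ℝ (fun z => kronPow k (B z) K J) y :=
  differentiableAt_prod (s := Finset.univ) (f := fun m z => B z (K m) (J m))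
    fun m _ => hB (K m) (J m)

/-- The covariant derivative transforms as a tensor. -/
lemma covDerivOf_transform {G G' : E → Mat} {F : E → E} {y : E} (hG : ∀ z, (G z).IsSymm)
    (hF : ContDiffAt ℝ ∞ F y) (hGd : ∀ a b, DifferentiableAt ℝ (fun z => G z a b) (F y))
    (hGG' : ∀ᶠ z in nhds y, G' z = (jac F z).transpose * G (F z) * jac F z)
    (hdet : IsUnit (G (F y)).det) (hdet' : IsUnit (jac F y).det)
    {t t' : (Fin k → Fin n) → E → ℝ} (ht : ∀ K, DifferentiableAt ℝ (t K) (F y))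
    (htt' : ∀ J, ∀ᶠ z in nhds y, t' J z = ∑ K, kronPow k (jac F z) K J * t K (F z))
    (i : Fin n) (J : Fin k → Fin n) :
    covDerivOf G' t' i J y =
      ∑ c, jac F y c i * ∑ K, kronPow k (jac F y) K J * covDerivOf G t c K (F y) := by
  have hFd : DifferentiableAt ℝ F y := hF.differentiableAt (by simp)
  have hAd : ∀ a i, DifferentiableAt ℝ (fun z => jac F z a i) y :=
    fun a i => (contDiffAt_jac hF a i).differentiableAt (by simp)
  have htFd : ∀ K, DifferentiableAt ℝ (fun z => t K (F z)) y := fun K => (ht K).comp y hFd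
  have hkd := fun K => differentiableAt_kronPow hAd K J
  let P : (Fin k → Fin n) → Fin k → ℝ :=
    fun K μ => ∏ m ∈ Finset.univ.erase μ, jac F y (K m) (J m)
  let H : Fin n → Fin n → ℝ := fun a r => pderiv i (fun z => jac F z a r) y
  -- The first sum is the non-tensorial part, from differentiating the Jacobians. In `e2` the
  -- inhomogeneous term of the Christoffel law yields the same sum, and the two cancel.
  have e1 : pderiv i (t' J) y = ∑ μ, ∑ K, P K μ * H (K μ) (J μ) * t K (F y) +
      ∑ c, jac F y c i * ∑ K, kronPow k (jac F y) K J * pderiv c (t K) (F y) := by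
    rw [pderiv_congr (htt' J), pderiv_sum fun K _ => (hkd K).fun_mul (htFd K)]
    simp only [pderiv_mul (hkd _) (htFd _), pderiv_kronPow hAd, pderiv_comp hFd (ht _),
      Finset.sum_add_distrib, Finset.sum_mul, Finset.mul_sum]
    congr 1
    · rw [Finset.sum_comm]
    · rw [Finset.sum_comm]
      exact Finset.sum_congr rfl fun c _ => Finset.sum_congr rfl fun K _ => by ring
  have e2 : ∀ μ, ∑ l, christoffelOf G' l i (J μ) y * t' (Function.update J μ l) y =
      ∑ K, P K μ * H (K μ) (J μ) * t K (F y) +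
        ∑ c, jac F y c i * ∑ K, kronPow k (jac F y) K J *
          ∑ l, christoffelOf G l c (K μ) (F y) * t (Function.update K μ l) (F y) := by
    intro μ
    have f1 : ∑ l, christoffelOf G' l i (J μ) y * t' (Function.update J μ l) y =
        ∑ K, P K μ * t K (F y) * ∑ l, jac F y (K μ) l * christoffelOf G' l i (J μ) y := by
      simp only [(htt' _).self_of_nhds, kronPow_update_right, Finset.mul_sum]
      rw [Finset.sum_comm]
      exact Finset.sum_congr rfl fun c _ => Finset.sum_congr rfl fun K _ => by simp only [P]; ring
    have f2 : ∀ c, ∑ K, kronPow k (jac F y) K J *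
          ∑ l, christoffelOf G l c (K μ) (F y) * t (Function.update K μ l) (F y) =
        ∑ K, P K μ * t K (F y) * ∑ b, christoffelOf G (K μ) c b (F y) * jac F y b (J μ) := by
      intro c
      simp only [Finset.mul_sum]
      rw [sum_sum_update_swap μ]
      refine Finset.sum_congr rfl fun K _ => Finset.sum_congr rfl fun l _ => ?_
      simp only [Function.update_self, Function.update_idem, Function.update_eq_self,
        kronPow_update_left, P]
      ring
    rw [f1]
    simp only [f2]
    simp only [sum_jac_christoffel hG hF hGd hGG' hdet hdet', Finset.mul_sum, mul_add,
      Finset.sum_add_distrib]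
    rw [add_comm]
    congr 1
    · exact Finset.sum_congr rfl fun K _ => by simp only [H]; ring
    · rw [Finset.sum_comm]
      refine Finset.sum_congr rfl fun c _ => Finset.sum_congr rfl fun K _ =>
        Finset.sum_congr rfl fun b _ => by ring
  rw [covDerivOf, e1, Finset.sum_congr rfl fun μ _ => e2 μ, Finset.sum_add_distrib,
    add_sub_add_left_eq_sub, Finset.sum_comm, ← Finset.sum_sub_distrib]
  refine Finset.sum_congr rfl fun c _ => ?_
  rw [← Finset.mul_sum, ← mul_sub, Finset.sum_comm, ← Finset.sum_sub_distrib]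
  simp only [covDerivOf, mul_sub, Finset.mul_sum]

/-- The contravariant transformation law of the inverse metric, for `AᵀBA` the metric in the new
coordinates. -/
lemma mul_inv_mul_transpose {A B : Mat} (hA : IsUnit A.det) :
    A * (A.transpose * B * A)⁻¹ * A.transpose = B⁻¹ := by
  have hAT : IsUnit A.transpose.det := by rwa [Matrix.det_transpose]
  rw [Matrix.mul_inv_rev, Matrix.mul_inv_rev, ← Matrix.mul_assoc, Matrix.mul_nonsing_inv _ hA,
    Matrix.one_mul, Matrix.mul_assoc, Matrix.nonsing_inv_mul _ hAT, Matrix.mul_one]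

/-- The adjoint of the covariant derivative transforms as a tensor. -/
lemma covAdjointOf_transform {G G' : E → Mat} {F : E → E} {y : E} (hG : ∀ z, (G z).IsSymm)
    (hF : ContDiffAt ℝ ∞ F y) (hGd : ∀ a b, DifferentiableAt ℝ (fun z => G z a b) (F y))
    (hGG' : ∀ᶠ z in nhds y, G' z = (jac F z).transpose * G (F z) * jac F z)
    (hdet : IsUnit (G (F y)).det) (hdet' : IsUnit (jac F y).det)
    {t t' : (Fin (k + 1) → Fin n) → E → ℝ} (ht : ∀ K, DifferentiableAt ℝ (t K) (F y))
    (htt' : ∀ J, ∀ᶠ z in nhds y, t' J z = ∑ K, kronPow (k + 1) (jac F z) K J * t K (F z))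
    (J : Fin k → Fin n) :
    covAdjointOf G' t' J y = ∑ K, kronPow k (jac F y) K J * covAdjointOf G t K (F y) := by
  have hinv := mul_inv_mul_transpose (B := G (F y)) hdet'
  rw [← hGG'.self_of_nhds] at hinv
  have hentry : ∀ a b, (G (F y))⁻¹ a b =
      ∑ p, ∑ r, (G' y)⁻¹ p r * jac F y a p * jac F y b r := by
    intro a b
    rw [← hinv]
    simp only [Matrix.mul_apply, Matrix.transpose_apply, Finset.sum_mul]
    rw [Finset.sum_comm]
    exact Finset.sum_congr rfl fun p _ => Finset.sum_congr rfl fun r _ => by ring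
  simp only [covAdjointOf, covDerivOf_transform hG hF hGd hGG' hdet hdet' ht htt', sum_cons,
    kronPow_cons, hentry, mul_neg, Finset.sum_neg_distrib]
  congr 1
  simp only [Finset.mul_sum, Finset.sum_mul]
  have swap : ∀ Φ : Fin n → Fin n → Fin n → Fin n → (Fin k → Fin n) → ℝ,
      ∑ p, ∑ r, ∑ b, ∑ a, ∑ K, Φ p r b a K = ∑ K, ∑ a, ∑ b, ∑ p, ∑ r, Φ p r b a K := by
    intro Φ
    simp only [← Fintype.sum_prod_type']
    exact Fintype.sum_equiv
      { toFun := fun x => (x.2.2.2.2, x.2.2.2.1, x.2.2.1, x.1, x.2.1)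
        invFun := fun x => (x.2.2.2.1, x.2.2.2.2, x.2.2.1, x.2.1, x.1)
        left_inv := fun _ => rfl
        right_inv := fun _ => rfl } _ _ fun _ => rfl
  rw [swap]
  refine Finset.sum_congr rfl fun K _ => Finset.sum_congr rfl fun a _ =>
    Finset.sum_congr rfl fun b _ => Finset.sum_congr rfl fun p _ =>
    Finset.sum_congr rfl fun r _ => by ring

/-- Read as bilinear forms on multi-indexed vectors, both sides are governed by Kronecker powers.
These are multiplicative, so the claim reduces to `mul_inv_mul_transpose`. -/
lemma inner_transform {A B : Mat} (hA : IsUnit A.det) {S S' T T' : (Fin k → Fin n) → ℝ}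
    (hS : ∀ J, S' J = ∑ K, kronPow k A K J * S K) (hT : ∀ J, T' J = ∑ K, kronPow k A K J * T K) :
    ∑ I, ∑ J, kronPow k (A.transpose * B * A)⁻¹ I J * S' I * T' J =
      ∑ I, ∑ J, kronPow k B⁻¹ I J * S I * T J := by
  have conv : ∀ (X : Matrix (Fin k → Fin n) (Fin k → Fin n) ℝ) (u v : (Fin k → Fin n) → ℝ),
      ∑ I, ∑ J, X I J * u I * v J = u ⬝ᵥ X.mulVec v := by
    intro X u v
    simp only [dotProduct, Matrix.mulVec, Finset.mul_sum]
    exact Finset.sum_congr rfl fun I _ => Finset.sum_congr rfl fun J _ => by ring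
  have hS' : S' = (kronPow k A).transpose.mulVec S := funext hS
  have hT' : T' = (kronPow k A).transpose.mulVec T := funext hT
  rw [conv, conv, hS', hT', Matrix.mulVec_transpose, ← Matrix.dotProduct_mulVec,
    Matrix.mulVec_mulVec, Matrix.mulVec_mulVec, ← kronPow_transpose, ← kronPow_mul, ← kronPow_mul,
    mul_inv_mul_transpose hA]

end ChangeOfCoordinates

/-! ### The test tensor and the cancellation of the volume density -/

section TestTensor

variable {n k : ℕ}

local notation "E" => EuclideanSpace ℝ (Fin n)
local notation "Mat" => Matrix (Fin n) (Fin n) ℝ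

/-- Metric compatibility splits the derivative of each factor `g_{K_μ P_μ}` in two. The half acting
on `K_μ` cancels the correction terms of `∇`; the other half expresses `∇_b ∂_{P_μ}`, since `P`
labels coordinate fields and is not a tensor index. -/
lemma covDerivOf_kronPow {G : E → Mat} (hG : ∀ z, (G z).IsSymm) {y : E}
    (hGd : ∀ a b, DifferentiableAt ℝ (fun z => G z a b) y) (hdet : IsUnit (G y).det)
    {f : E → ℝ} (hf : DifferentiableAt ℝ f y) (b : Fin n) (K P : Fin k → Fin n) :
    covDerivOf G (fun K z => f z * kronPow k (G z) K P) b K y =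
      pderiv b f y * kronPow k (G y) K P +
        f y * ∑ μ, ∑ l, christoffelOf G l b (P μ) y * kronPow k (G y) K (Function.update P μ l) := by
  rw [covDerivOf, pderiv_mul hf (differentiableAt_kronPow hGd K P), add_sub_assoc]
  congr 1
  rw [pderiv_kronPow hGd, Finset.mul_sum, Finset.mul_sum, ← Finset.sum_sub_distrib]
  refine Finset.sum_congr rfl fun μ _ => ?_
  rw [pderiv_metric hG hdet]
  simp only [kronPow_update_left, kronPow_update_right, Finset.mul_sum, mul_add,
    ← Finset.sum_add_distrib, ← Finset.sum_sub_distrib]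
  exact Finset.sum_congr rfl fun l _ => by ring

lemma sum_inv_mul {B : Mat} (hB : B.IsSymm) (hdet : IsUnit B.det) (b i : Fin n) :
    ∑ a, B⁻¹ a b * B a i = if b = i then 1 else 0 := by
  have h : B⁻¹ * B = 1 := Matrix.nonsing_inv_mul _ hdet
  have hs : (B⁻¹).IsSymm := by rw [Matrix.IsSymm, Matrix.transpose_nonsing_inv, hB.eq]
  rw [← Matrix.one_apply, ← h, Matrix.mul_apply]
  exact Finset.sum_congr rfl fun a _ => by rw [hs.apply a b]

/-- Contraction with the inverse metric forces `b = i`, except where the Christoffel symbol acts on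
the label `i` itself. There it leaves the trace `Γ^b_{bi}`, which is `Γ^l_{il}` by symmetry in the
lower indices. -/
lemma covAdjointOf_kronPow {G : E → Mat} (hG : ∀ z, (G z).IsSymm) {y : E}
    (hGd : ∀ a b, DifferentiableAt ℝ (fun z => G z a b) y) (hdet : IsUnit (G y).det)
    {f : E → ℝ} (hf : DifferentiableAt ℝ f y) (i : Fin n) (J K : Fin k → Fin n) :
    covAdjointOf G (fun P z => f z * kronPow (k + 1) (G z) P (Fin.cons i J)) K y =
      -((pderiv i f y + f y * ∑ l, christoffelOf G l i l y) * kronPow k (G y) K J +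
        f y * ∑ μ, ∑ l, christoffelOf G l i (J μ) y *
          kronPow k (G y) K (Function.update J μ l)) := by
  rw [covAdjointOf, Finset.sum_comm]
  congr 1
  have hsum : ∀ b s, ∑ a, (G y)⁻¹ a b * G y a s = if b = s then 1 else 0 :=
    fun b s => sum_inv_mul (hG y) hdet b s
  have hb : ∀ b, ∑ a, (G y)⁻¹ a b *
      covDerivOf G (fun P z => f z * kronPow (k + 1) (G z) P (Fin.cons i J)) b (Fin.cons a K) y =
      (if b = i then pderiv b f y * kronPow k (G y) K J else 0) +
        f y * christoffelOf G b b i y * kronPow k (G y) K J +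
        (if b = i then f y * ∑ μ, ∑ l, christoffelOf G l b (J μ) y *
          kronPow k (G y) K (Function.update J μ l) else 0) := by
    intro b
    simp only [covDerivOf_kronPow hG hGd hdet hf, Fin.sum_univ_succ, Fin.cons_zero, Fin.cons_succ,
      Fin.update_cons_zero, ← Fin.cons_update, kronPow_cons]
    have g1 : ∀ a, (G y)⁻¹ a b * (pderiv b f y * (G y a i * kronPow k (G y) K J) +
        f y * (∑ l, christoffelOf G l b i y * (G y a l * kronPow k (G y) K J) +
          ∑ μ, ∑ l, christoffelOf G l b (J μ) y *
            (G y a i * kronPow k (G y) K (Function.update J μ l)))) =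
        ((G y)⁻¹ a b * G y a i) * (pderiv b f y * kronPow k (G y) K J) +
        ∑ l, ((G y)⁻¹ a b * G y a l) * (f y * christoffelOf G l b i y * kronPow k (G y) K J) +
        ((G y)⁻¹ a b * G y a i) * (f y * ∑ μ, ∑ l, christoffelOf G l b (J μ) y *
          kronPow k (G y) K (Function.update J μ l)) := by
      intro a
      simp only [mul_add, Finset.mul_sum]
      rw [add_assoc]
      congr 1
      · ring
      · congr 1
        · exact Finset.sum_congr rfl fun l _ => by ring
        · exact Finset.sum_congr rfl fun μ _ => Finset.sum_congr rfl fun l _ => by ring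
    simp only [g1, Finset.sum_add_distrib, ← Finset.sum_mul, hsum, ite_mul, one_mul, zero_mul]
    rw [Finset.sum_comm]
    simp only [← Finset.sum_mul, hsum, ite_mul, one_mul, zero_mul, Finset.sum_ite_eq,
      Finset.mem_univ, if_true]
  rw [Finset.sum_congr rfl fun b _ => hb b]
  simp only [Finset.sum_add_distrib, Finset.sum_ite_eq', Finset.mem_univ, if_true, add_mul,
    Finset.mul_sum, Finset.sum_mul, christoffelOf_symm hG _ _ i]

/-- Jacobi's formula. The Leibniz expansion is differentiated one column at a time, and Cramer's
rule turns each replaced column into a row of the adjugate. -/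
lemma pderiv_det {G : E → Mat} {y : E} (hGd : ∀ a b, DifferentiableAt ℝ (fun z => G z a b) y)
    (hdet : IsUnit (G y).det) (i : Fin n) :
    pderiv i (fun z => (G z).det) y =
      (G y).det * ∑ a, ∑ b, (G y)⁻¹ a b * pderiv i (fun z => G z b a) y := by
  have h1 : pderiv i (fun z => (G z).det) y =
      ∑ a, ((G y).updateCol a fun b => pderiv i (fun z => G z b a) y).det := by
    simp only [Matrix.det_apply']
    rw [pderiv_sum fun σ _ => DifferentiableAt.const_mul
      (differentiableAt_prod fun m _ => hGd _ _) _, Finset.sum_comm]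
    refine Finset.sum_congr rfl fun σ _ => ?_
    rw [pderiv_mul (differentiableAt_const _) (differentiableAt_prod fun m _ => hGd _ _),
      pderiv_prod fun m _ => hGd _ _]
    have : pderiv i (fun _ : E => ((σ.sign : ℤ) : ℝ)) y = 0 := by simp [pderiv]
    rw [this, zero_mul, zero_add, Finset.mul_sum]
    refine Finset.sum_congr rfl fun a _ => ?_
    rw [← Finset.prod_erase_mul _ _ (Finset.mem_univ a), Matrix.updateCol_self]
    congr 2
    refine Finset.prod_congr rfl fun m hm => ?_
    rw [Matrix.updateCol_ne (Finset.ne_of_mem_erase hm)]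
  have hadj : (G y).adjugate = (G y).det • (G y)⁻¹ := by
    rw [Matrix.inv_def, smul_smul, Ring.mul_inverse_cancel _ hdet, one_smul]
  rw [h1, Finset.mul_sum]
  refine Finset.sum_congr rfl fun a _ => ?_
  rw [← Matrix.cramer_apply, Matrix.cramer_eq_adjugate_mulVec, hadj]
  simp [Matrix.mulVec, dotProduct, Finset.mul_sum, mul_assoc]

/-- Jacobi's formula with metric compatibility inserted: each of its two sums contracts to the same
trace, hence the factor 2. -/
lemma pderiv_det_eq_christoffel {G : E → Mat} (hG : ∀ z, (G z).IsSymm) {y : E}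
    (hGd : ∀ a b, DifferentiableAt ℝ (fun z => G z a b) y) (hdet : IsUnit (G y).det) (i : Fin n) :
    pderiv i (fun z => (G z).det) y = 2 * (G y).det * ∑ l, christoffelOf G l i l y := by
  rw [pderiv_det hGd hdet, mul_comm 2, mul_assoc]
  congr 1
  have hs : ∀ a b, (G y)⁻¹ a b = (G y)⁻¹ b a := fun a b => by
    have : ((G y)⁻¹).IsSymm := by rw [Matrix.IsSymm, Matrix.transpose_nonsing_inv, (hG y).eq]
    exact this.apply b a
  have hsum : ∀ b s, ∑ a, (G y)⁻¹ a b * G y a s = if b = s then 1 else 0 :=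
    fun b s => sum_inv_mul (hG y) hdet b s
  simp only [pderiv_metric hG hdet, mul_add, Finset.sum_add_distrib, Finset.mul_sum, two_mul]
  congr 1
  · have : ∀ b, ∑ a, ∑ l, (G y)⁻¹ a b * (christoffelOf G l i b y * G y l a) =
        christoffelOf G b i b y := by
      intro b
      rw [Finset.sum_comm]
      have : ∀ l a, (G y)⁻¹ a b * (christoffelOf G l i b y * G y l a) =
          ((G y)⁻¹ a b * G y a l) * christoffelOf G l i b y := by
        intro l a
        rw [(hG y).apply a l]; ring
      simp only [this, ← Finset.sum_mul, hsum, ite_mul, one_mul, zero_mul, Finset.sum_ite_eq,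
        Finset.mem_univ, if_true]
    rw [Finset.sum_comm]
    exact Finset.sum_congr rfl fun b _ => this b
  · refine Finset.sum_congr rfl fun a _ => ?_
    rw [Finset.sum_comm]
    have : ∀ l b, (G y)⁻¹ a b * (christoffelOf G l i a y * G y b l) =
          ((G y)⁻¹ b a * G y b l) * christoffelOf G l i a y := by
      intro l b
      rw [hs a b]; ring
    simp only [this, ← Finset.sum_mul, hsum, ite_mul, one_mul, zero_mul, Finset.sum_ite_eq,
        Finset.mem_univ, if_true]

lemma differentiableAt_det {G : E → Mat} {y : E}
    (hGd : ∀ a b, DifferentiableAt ℝ (fun z => G z a b) y) :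
    DifferentiableAt ℝ (fun z => (G z).det) y := by
  simp only [Matrix.det_apply']
  exact DifferentiableAt.fun_sum fun σ _ => DifferentiableAt.const_mul
      (differentiableAt_prod fun m _ => hGd _ _) _

lemma pderiv_sqrt_det {G : E → Mat} (hG : ∀ z, (G z).IsSymm) {y : E}
    (hGd : ∀ a b, DifferentiableAt ℝ (fun z => G z a b) y) (hdet : ∀ᶠ z in nhds y, 0 < (G z).det)
    (i : Fin n) :
    pderiv i (fun z => √(G z).det) y = √(G y).det * ∑ l, christoffelOf G l i l y := by
  have hy : 0 < (G y).det := hdet.self_of_nhds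
  have hd : DifferentiableAt ℝ (fun z => √(G z).det) y :=
    (differentiableAt_det hGd).sqrt hy.ne'
  have h1 := pderiv_det_eq_christoffel hG hGd hy.ne'.isUnit i
  -- The derivative of the root is found by differentiating its square and cancelling the positive
  -- root.
  have h2 : pderiv i (fun z => (G z).det) y = pderiv i (fun z => √(G z).det * √(G z).det) y :=
    pderiv_congr (hdet.mono fun z hz => (Real.mul_self_sqrt hz.le).symm)
  rw [pderiv_mul hd hd] at h2
  have hpos : 0 < √(G y).det := Real.sqrt_pos.2 hy
  have hsq := Real.mul_self_sqrt hy.le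
  apply mul_left_cancel₀ hpos.ne'
  rw [← mul_assoc, hsq]
  linarith

/-- Raising undoes lowering: this is how pairing with the test tensor isolates a single component.
-/
lemma sum_kronPow_inv_mul {B : Mat} (hdet : IsUnit B.det) (a : (Fin k → Fin n) → ℝ)
    (P : Fin k → Fin n) :
    ∑ I, ∑ K, kronPow k B⁻¹ I K * a I * kronPow k B K P = a P := by
  have h : kronPow k B⁻¹ * kronPow k B = 1 := by
    rw [← kronPow_mul, Matrix.nonsing_inv_mul _ hdet, kronPow_one]
  have h2 : ∀ I, ∑ K, kronPow k B⁻¹ I K * a I * kronPow k B K P = if I = P then a I else 0 := by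
    intro I
    have := congrFun (congrFun h I) P
    rw [Matrix.mul_apply, Matrix.one_apply] at this
    calc _ = (∑ K, kronPow k B⁻¹ I K * kronPow k B K P) * a I := by
          rw [Finset.sum_mul]; exact Finset.sum_congr rfl fun K _ => by ring
      _ = _ := by rw [this]; split_ifs <;> simp
  simp [h2]

/-- Pairing a tensor with the adjoint of the covariant derivative of a test tensor. -/
lemma inner_covAdjointOf_kronPow {G : E → Mat} (hG : ∀ z, (G z).IsSymm) {y : E}
    (hGd : ∀ a b, DifferentiableAt ℝ (fun z => G z a b) y) (hdet : ∀ᶠ z in nhds y, 0 < (G z).det)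
    {ψ : E → ℝ} (hψ : DifferentiableAt ℝ ψ y) (a : (Fin k → Fin n) → ℝ) (i : Fin n)
    (J : Fin k → Fin n) :
    √(G y).det * ∑ I, ∑ K, kronPow k (G y)⁻¹ I K * a I *
        covAdjointOf G (fun P z => (ψ z / √(G z).det) * kronPow (k + 1) (G z) P (Fin.cons i J)) K y =
      -(a J * pderiv i ψ y +
        (∑ μ, ∑ l, christoffelOf G l i (J μ) y * a (Function.update J μ l)) * ψ y) := by
  have hy : 0 < (G y).det := hdet.self_of_nhds
  have hu := hy.ne'.isUnit
  have hpos : 0 < √(G y).det := Real.sqrt_pos.2 hy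
  have hd : DifferentiableAt ℝ (fun z => √(G z).det) y :=
    (differentiableAt_det hGd).sqrt hy.ne'
  have hf : DifferentiableAt ℝ (fun z => ψ z / √(G z).det) y := by
    simp only [div_eq_mul_inv]
    exact hψ.fun_mul (hd.fun_inv hpos.ne')
  set f : E → ℝ := fun z => ψ z / √(G z).det with hfdef
  -- Differentiating `ψ = f √det G` produces the trace term that the divergence contributes in
  -- `key`; it is thereby absorbed into `∂_i ψ`.
  have hψf : pderiv i ψ y = pderiv i f y * √(G y).det + f y * pderiv i (fun z => √(G z).det) y := by
    rw [← pderiv_mul hf hd]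
    refine pderiv_congr (hdet.mono fun z hz => ?_)
    simp only [hfdef]
    rw [div_mul_cancel₀ _ (Real.sqrt_pos.2 hz).ne']
  rw [pderiv_sqrt_det hG hGd hdet] at hψf
  have hfy : ψ y = f y * √(G y).det := (div_mul_cancel₀ _ hpos.ne').symm
  have key : ∑ I, ∑ K, kronPow k (G y)⁻¹ I K * a I *
        covAdjointOf G (fun P z => f z * kronPow (k + 1) (G z) P (Fin.cons i J)) K y =
      -((pderiv i f y + f y * ∑ l, christoffelOf G l i l y) * a J +
        f y * ∑ μ, ∑ l, christoffelOf G l i (J μ) y * a (Function.update J μ l)) := by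
    simp only [covAdjointOf_kronPow hG hGd hu hf]
    conv_rhs => rw [← sum_kronPow_inv_mul hu a J]
    simp only [fun μ l => (sum_kronPow_inv_mul hu a (Function.update J μ l)).symm]
    simp only [mul_neg, mul_add, Finset.sum_neg_distrib, Finset.sum_add_distrib, Finset.mul_sum]
    congr 2
    · exact Finset.sum_congr rfl fun I _ => Finset.sum_congr rfl fun K _ => by ring
    · have swap : ∀ Φ : (Fin k → Fin n) → (Fin k → Fin n) → Fin k → Fin n → ℝ,
          ∑ I, ∑ K, ∑ μ, ∑ l, Φ I K μ l = ∑ μ, ∑ l, ∑ I, ∑ K, Φ I K μ l := by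
        intro Φ
        simp only [← Fintype.sum_prod_type']
        exact Fintype.sum_equiv
          { toFun := fun x => (x.2.2.1, x.2.2.2, x.1, x.2.1)
            invFun := fun x => (x.2.2.1, x.2.2.2, x.1, x.2.1)
            left_inv := fun _ => rfl
            right_inv := fun _ => rfl } _ _ fun _ => rfl
      rw [swap]
      exact Finset.sum_congr rfl fun μ _ => Finset.sum_congr rfl fun l _ =>
        Finset.sum_congr rfl fun I _ => Finset.sum_congr rfl fun K _ => by ring
  rw [key, hψf, hfy]
  ring

end TestTensor

/-! ### Passing between charts on the manifold -/

section Charts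

variable {n k : ℕ} {M : Type*} [TopologicalSpace M] [ChartedSpace (EuclideanSpace ℝ (Fin n)) M]

local notation "E" => EuclideanSpace ℝ (Fin n)
local notation "Chart" => OpenPartialHomeomorph M (EuclideanSpace ℝ (Fin n))

/-- `coordVec`, as a vector of the model space. -/
def coordVecModel (e : Chart) (y : E) (i : Fin n) : E := coordVec e y i

/-- Evaluation of a tensor field at a point on vectors of the model space. -/
def TensorField.app (T : TensorField n M k) (x : M) (v : Fin k → E) : ℝ := T x v

/-- Every tangent space is definitionally the model space. Working there lets the base point be
rewritten without transporting vectors along equalities. -/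
lemma coeff_eq_app (e : Chart) (T : TensorField n M k) (J : Fin k → Fin n) (y : E) :
    coeff e T J y = T.app (e.symm y) (fun m => coordVecModel e y (J m)) := rfl

lemma coeff_eq_zero {T : TensorField n M k} {e : Chart} {y : E} (h : T (e.symm y) = 0)
    (J : Fin k → Fin n) : coeff e T J y = 0 := by
  rw [coeff, h]; rfl

lemma TensorField.app_sum_smul (T : TensorField n M k) (x : M) (A : Matrix (Fin n) (Fin n) ℝ)
    (v : Fin n → E) (J : Fin k → Fin n) :
    T.app x (fun m => ∑ a, A a (J m) • v a) =
      ∑ K, kronPow k A K J * T.app x (fun m => v (K m)) := by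
  let T' : MultilinearMap ℝ (fun _ : Fin k => E) ℝ := T x
  change T' (fun m => ∑ a, A a (J m) • v a) = ∑ K, kronPow k A K J * T' (fun m => v (K m))
  rw [T'.map_sum]
  refine Finset.sum_congr rfl fun K _ => ?_
  rw [T'.map_smul_univ]
  rfl

lemma contDiffAt_transition {e c : Chart} (he : e ∈ IsManifold.maximalAtlas (𝓡 n) ∞ M)
    (hc : c ∈ IsManifold.maximalAtlas (𝓡 n) ∞ M) {y : E} (hy : y ∈ e.target)
    (hyc : e.symm y ∈ c.source) : ContDiffAt ℝ ∞ (c ∘ e.symm) y :=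
  contMDiffAt_iff_contDiffAt.1
    ((contMDiffAt_of_mem_maximalAtlas hc hyc).comp y (contMDiffAt_symm_of_mem_maximalAtlas he hy))

lemma mfderiv_transition {e c : Chart} (he : e ∈ IsManifold.maximalAtlas (𝓡 n) ∞ M)
    (hc : c ∈ IsManifold.maximalAtlas (𝓡 n) ∞ M) {y : E} (hy : y ∈ e.target)
    (hyc : e.symm y ∈ c.source) (a j : Fin n) :
    coordCovec c (e.symm y) a (coordVec e y j) = jac (c ∘ e.symm) y a j := by
  have h := mfderiv_comp y ((contMDiffAt_of_mem_maximalAtlas hc hyc).mdifferentiableAt (by simp))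
    ((contMDiffAt_symm_of_mem_maximalAtlas he hy).mdifferentiableAt (by simp))
  rw [mfderiv_eq_fderiv] at h
  have h2 := congrArg (fun L : E →L[ℝ] E => L (EuclideanSpace.single j 1) a) h
  exact h2.symm

lemma coeff_tensorOfCoeffs {e c : Chart} (he : e ∈ IsManifold.maximalAtlas (𝓡 n) ∞ M)
    (hc : c ∈ IsManifold.maximalAtlas (𝓡 n) ∞ M) {y : E} (hy : y ∈ e.target)
    (hyc : e.symm y ∈ c.source) (a : (Fin k → Fin n) → ℝ) (J : Fin k → Fin n) :
    tensorOfCoeffs c (e.symm y) a (fun m => coordVec e y (J m)) =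
      ∑ K, kronPow k (jac (c ∘ e.symm) y) K J * a K := by
  rw [tensorOfCoeffs, sum_apply]
  refine Finset.sum_congr rfl fun K _ => ?_
  rw [smul_apply, MultilinearMap.compLinearMap_apply,
    MultilinearMap.mkPiAlgebra_apply, smul_eq_mul, mul_comm]
  simp only [mfderiv_transition he hc hy hyc]
  rfl

/-- The covectors `dxᵃ` are dual to the coordinate vectors, which are therefore independent.
Positive definiteness of the Gram matrix rests on this. -/
lemma coordVecModel_sum_ne_zero {e : Chart} (he : e ∈ IsManifold.maximalAtlas (𝓡 n) ∞ M) {y : E}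
    (hy : y ∈ e.target) {x : Fin n → ℝ} (hx : x ≠ 0) : ∑ i, x i • coordVecModel e y i ≠ 0 := by
  intro h
  apply hx
  funext a
  have h1 : ∀ i, coordCovec e (e.symm y) a (coordVec e y i) = if a = i then 1 else 0 := by
    intro i
    rw [mfderiv_transition he he hy (e.map_target hy), jac_self hy, Matrix.one_apply]
  let L : E →ₗ[ℝ] ℝ := coordCovec e (e.symm y) a
  have h1' : ∀ i, L (coordVecModel e y i) = if a = i then 1 else 0 := h1
  have h2 := congrArg L h
  rw [map_sum, map_zero] at h2
  simpa [h1'] using h2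

/-- The chain rule for `e.symm = c.symm ∘ (c ∘ e.symm)`, valid near `y`. The transformation laws of
coefficients and of the metric follow by multilinearity. -/
lemma coordVecModel_transition {e c : Chart} (he : e ∈ IsManifold.maximalAtlas (𝓡 n) ∞ M)
    (hc : c ∈ IsManifold.maximalAtlas (𝓡 n) ∞ M) {y : E} (hy : y ∈ e.target)
    (hyc : e.symm y ∈ c.source) (j : Fin n) :
    coordVecModel e y j =
      ∑ a, jac (c ∘ e.symm) y a j • coordVecModel c ((c ∘ e.symm) y) a := by
  have hev : e.symm =ᶠ[nhds y] c.symm ∘ (c ∘ e.symm) := by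
    filter_upwards [eventually_mem_target hy hyc] with z hz
    exact (c.left_inv hz.2).symm
  have h := mfderiv_comp y (f := c ∘ e.symm) (g := c.symm) (I := 𝓡 n) (I' := 𝓡 n) (I'' := 𝓡 n)
    ((contMDiffAt_symm_of_mem_maximalAtlas hc (c.map_source hyc)).mdifferentiableAt (by simp))
    (contMDiffAt_iff_contDiffAt.2 (contDiffAt_transition he hc hy hyc) |>.mdifferentiableAt
      (by simp))
  rw [mfderiv_eq_fderiv] at h
  have h0 : (mfderiv (𝓡 n) (𝓡 n) e.symm y : E →L[ℝ] E) =
      mfderiv (𝓡 n) (𝓡 n) (c.symm ∘ (c ∘ e.symm)) y := hev.mfderiv_eq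
  let L : E →L[ℝ] E := mfderiv (𝓡 n) (𝓡 n) c.symm ((c ∘ e.symm) y)
  have h1 : coordVecModel e y j =
      L (fderiv ℝ (c ∘ e.symm) y (EuclideanSpace.single j 1)) := by
    have h2 := congrArg (fun L : E →L[ℝ] E => L (EuclideanSpace.single j 1)) (h0.trans h)
    exact h2
  rw [h1, sum_smul_single (fderiv ℝ (c ∘ e.symm) y (EuclideanSpace.single j 1)), map_sum]
  simp only [map_smul]
  rfl

lemma coeff_transition {e c : Chart} (he : e ∈ IsManifold.maximalAtlas (𝓡 n) ∞ M)
    (hc : c ∈ IsManifold.maximalAtlas (𝓡 n) ∞ M) {y : E} (hy : y ∈ e.target)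
    (hyc : e.symm y ∈ c.source) (T : TensorField n M k) (J : Fin k → Fin n) :
    coeff e T J y = ∑ K, kronPow k (jac (c ∘ e.symm) y) K J * coeff c T K ((c ∘ e.symm) y) := by
  simp only [coeff_eq_app, coordVecModel_transition he hc hy hyc]
  rw [T.app_sum_smul]
  simp only [Function.comp_apply, c.left_inv hyc]

lemma isUnit_det_jac {e c : Chart} (he : e ∈ IsManifold.maximalAtlas (𝓡 n) ∞ M)
    (hc : c ∈ IsManifold.maximalAtlas (𝓡 n) ∞ M) {y : E} (hy : y ∈ e.target)
    (hyc : e.symm y ∈ c.source) : IsUnit (jac (c ∘ e.symm) y).det := by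
  have hback : c.symm ((c ∘ e.symm) y) ∈ e.source := by
    rw [Function.comp_apply, c.left_inv hyc]; exact e.map_target hy
  have hd := (contDiffAt_transition he hc hy hyc).differentiableAt (by simp)
  have hd' := (contDiffAt_transition hc he (c.map_source hyc) hback).differentiableAt (by simp)
  have hev : (e ∘ c.symm) ∘ (c ∘ e.symm) =ᶠ[nhds y] id := by
    filter_upwards [eventually_mem_target hy hyc] with z hz
    simp [c.left_inv hz.2, e.right_inv hz.1]
  have h := hev.fderiv_eq (𝕜 := ℝ)
  rw [fderiv_comp y hd' hd, fderiv_id] at h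
  have h2 : (fderiv ℝ (e ∘ c.symm) ((c ∘ e.symm) y)).det * (fderiv ℝ (c ∘ e.symm) y).det = 1 := by
    have := congrArg ContinuousLinearMap.det h
    simpa [ContinuousLinearMap.det, LinearMap.det_comp] using this
  rw [det_jac]
  exact IsUnit.of_mul_eq_one_right _ h2

variable [IsManifold (𝓡 n) ∞ M]

variable (g : Metric n M)

/-- The metric, evaluated on vectors of the model space. -/
def Metric.app (g : Metric n M) (x : M) : E →L[ℝ] E →L[ℝ] ℝ := g.inner x

lemma gram_eq_app (e : Chart) (y : E) (i j : Fin n) :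
    gram g e y i j = Metric.app g (e.symm y) (coordVecModel e y i) (coordVecModel e y j) := rfl

lemma gram_isSymm (e : Chart) (y : E) : (gram g e y).IsSymm := by
  ext i j
  exact g.symm _ _ _

lemma gram_transition {e c : Chart} (he : e ∈ IsManifold.maximalAtlas (𝓡 n) ∞ M)
    (hc : c ∈ IsManifold.maximalAtlas (𝓡 n) ∞ M) {y : E} (hy : y ∈ e.target)
    (hyc : e.symm y ∈ c.source) :
    gram g e y = (jac (c ∘ e.symm) y).transpose * gram g c ((c ∘ e.symm) y) *
      jac (c ∘ e.symm) y := by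
  ext i j
  rw [gram_eq_app, coordVecModel_transition he hc hy hyc, coordVecModel_transition he hc hy hyc]
  simp only [map_sum, map_smul, sum_apply, smul_apply,
    Matrix.mul_apply, Matrix.transpose_apply, gram_eq_app, smul_eq_mul, Finset.mul_sum,
    Finset.sum_mul, Function.comp_apply, c.left_inv hyc]
  exact Finset.sum_congr rfl fun a _ => Finset.sum_congr rfl fun b _ => by ring

lemma gram_det_pos {e : Chart} (he : e ∈ IsManifold.maximalAtlas (𝓡 n) ∞ M) {y : E}
    (hy : y ∈ e.target) : 0 < (gram g e y).det := by
  apply Matrix.PosDef.det_pos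
  apply Matrix.PosDef.of_dotProduct_mulVec_pos
  · ext i j
    simpa using (gram_isSymm g e y).apply i j
  · intro x hx
    have hpos : 0 < Metric.app g (e.symm y) (∑ i, x i • coordVecModel e y i)
        (∑ i, x i • coordVecModel e y i) :=
      g.pos _ _ (coordVecModel_sum_ne_zero he hy hx)
    have heq : star x ⬝ᵥ (gram g e y).mulVec x = Metric.app g (e.symm y)
        (∑ i, x i • coordVecModel e y i) (∑ i, x i • coordVecModel e y i) := by
      simp only [map_sum, map_smul, sum_apply, smul_apply,
        dotProduct, Matrix.mulVec, Finset.mul_sum, gram_eq_app, smul_eq_mul, star_trivial]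
      exact Finset.sum_congr rfl fun a _ => Finset.sum_congr rfl fun b _ => by
        rw [← gram_eq_app, ← gram_eq_app, (gram_isSymm g e y).apply]; ring
    rw [heq]
    exact hpos

/-- The coordinate field is the tangent map of `e.symm` applied to a constant field. -/
lemma contMDiffOn_coordVec {e : Chart} (he : e ∈ IsManifold.maximalAtlas (𝓡 n) ∞ M) (i : Fin n) :
    ContMDiffOn (𝓡 n) (𝓡 n).tangent ∞
      (fun y => (⟨e.symm y, coordVec e y i⟩ : TangentBundle (𝓡 n) M)) e.target := by
  have h1 := (contMDiffOn_symm_of_mem_maximalAtlas he).contMDiffOn_tangentMapWithin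
    (m := ∞) (by simp) e.open_target.uniqueMDiffOn
  have h2 : ContMDiffOn (𝓡 n) (𝓡 n).tangent ∞
      (fun y => (⟨y, (EuclideanSpace.single i 1 : E)⟩ : TangentBundle (𝓡 n) E)) e.target :=
    contMDiffOn_vectorSpace_iff_contDiffOn.2 contDiffOn_const
  refine (h1.comp h2 fun y hy => hy).congr fun y hy => ?_
  simp only [Function.comp_apply, tangentMapWithin, coordVec]
  rw [mfderivWithin_of_isOpen e.open_target hy]

lemma contDiffOn_gram {e : Chart} (he : e ∈ IsManifold.maximalAtlas (𝓡 n) ∞ M) (i j : Fin n) :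
    ContDiffOn ℝ ∞ (fun y => gram g e y i j) e.target := by
  rw [← contMDiffOn_iff_contDiffOn]
  intro y hy
  have : ContMDiffWithinAt (𝓡 n) ((𝓡 n).prod 𝓘(ℝ)) ∞
      (fun y => (⟨e.symm y, g.inner (e.symm y) (coordVec e y i) (coordVec e y j)⟩ :
        Bundle.TotalSpace ℝ (Bundle.Trivial M ℝ))) e.target y := by
    apply ContMDiffWithinAt.clm_bundle_apply₂ (F₁ := E) (F₂ := E)
    · exact ContMDiffAt.comp_contMDiffWithinAt y g.contMDiff.contMDiffAt
        (contMDiffOn_symm_of_mem_maximalAtlas he y hy)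
    · exact contMDiffOn_coordVec he i y hy
    · exact contMDiffOn_coordVec he j y hy
  simp only [Bundle.contMDiffWithinAt_totalSpace] at this
  exact this.2

lemma differentiableAt_gram {e : Chart} (he : e ∈ IsManifold.maximalAtlas (𝓡 n) ∞ M) {y : E}
    (hy : y ∈ e.target) (i j : Fin n) : DifferentiableAt ℝ (fun y => gram g e y i j) y :=
  ((contDiffOn_gram g he i j).contDiffAt (e.open_target.mem_nhds hy)).differentiableAt (by simp)

/-- In every chart, the coefficients of `∇*θ` are given by the classical formula. -/
lemma coeff_covAdjoint {θ : TensorField n M (k + 1)} (hθ : Smooth θ) {e : Chart}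
    (he : e ∈ IsManifold.maximalAtlas (𝓡 n) ∞ M) {y : E} (hy : y ∈ e.target) (J : Fin k → Fin n) :
    coeff e (covAdjoint g θ) J y = covAdjointOf (gram g e) (coeff e θ) J y := by
  -- The value of `∇*θ` at this point is defined through the preferred chart `c` there, so only the
  -- transition from `e` to `c` matters.
  set c := chartAt E (e.symm y)
  have hc : c ∈ IsManifold.maximalAtlas (𝓡 n) ∞ M := IsManifold.chart_mem_maximalAtlas _
  have hyc : e.symm y ∈ c.source := mem_chart_source _ _
  have hcy : (c ∘ e.symm) y ∈ c.target := c.map_source hyc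
  have hev := eventually_mem_target hy hyc
  rw [covAdjointOf_transform (gram_isSymm g c) (contDiffAt_transition he hc hy hyc)
    (differentiableAt_gram g hc hcy)
    (hev.mono fun z hz => gram_transition g he hc hz.1 hz.2)
    (gram_det_pos g hc hcy).ne'.isUnit (isUnit_det_jac he hc hy hyc)
    (fun K => ((hθ c hc K).contDiffAt (c.open_target.mem_nhds hcy)).differentiableAt (by simp))
    (fun K => hev.mono fun z hz => coeff_transition he hc hz.1 hz.2 θ K)]
  exact coeff_tensorOfCoeffs he hc hy hyc _ J

/-- In every chart, the inner product is given by the classical formula. -/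
lemma tensorInner_eq {e : Chart} (he : e ∈ IsManifold.maximalAtlas (𝓡 n) ∞ M) {y : E}
    (hy : y ∈ e.target) (S T : TensorField n M k) :
    tensorInner g S T (e.symm y) = tensorInnerCoord g e S T y := by
  set c := chartAt E (e.symm y) with hcdef
  have hc : c ∈ IsManifold.maximalAtlas (𝓡 n) ∞ M := IsManifold.chart_mem_maximalAtlas _
  have hyc : e.symm y ∈ c.source := mem_chart_source _ _
  have h := inner_transform (B := gram g c ((c ∘ e.symm) y)) (isUnit_det_jac he hc hy hyc)
    (coeff_transition he hc hy hyc S) (coeff_transition he hc hy hyc T)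
  rw [← gram_transition g he hc hy hyc] at h
  exact h.symm

end Charts

/-! ### The Riemannian volume in a chart -/

section Volume

variable {n : ℕ} {M : Type*} [TopologicalSpace M] [MeasurableSpace M] [BorelSpace M]

local notation "E" => EuclideanSpace ℝ (Fin n)
local notation "Chart" => OpenPartialHomeomorph M (EuclideanSpace ℝ (Fin n))

lemma measurableSet_target_inter_preimage (e : Chart) {A : Set M} (hA : MeasurableSet A) :
    MeasurableSet (e.target ∩ e.symm ⁻¹' A) := by
  have h : MeasurableSet (e.target.domRestrict e.symm ⁻¹' A) :=
    (continuousOn_iff_continuous_domRestrict.1 e.continuousOn_symm).measurable hA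
  have h2 := MeasurableSet.subtype_image e.open_target.measurableSet h
  convert h2 using 1
  ext y
  simp [Set.domRestrict, and_comm]

/-- `e.symm` is controlled only on `e.target`. Without a.e. measurability the `Measure.map` in
`chartVolume` would be zero by convention. -/
lemma aemeasurable_symm (e : Chart) (f : E → ENNReal) :
    AEMeasurable e.symm ((volume.restrict e.target).withDensity f) :=
  (e.continuousOn_symm.aemeasurable e.open_target.measurableSet).mono_ac
    (withDensity_absolutelyContinuous _ _)

variable [ChartedSpace (EuclideanSpace ℝ (Fin n)) M] [IsManifold (𝓡 n) ∞ M] (g : Metric n M)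

lemma chartVolume_apply (e : Chart) {A : Set M} (hA : MeasurableSet A) :
    chartVolume g e A =
      ∫⁻ y in e.target ∩ e.symm ⁻¹' A, ENNReal.ofReal (√(gram g e y).det) := by
  rw [chartVolume, Measure.map_apply_of_aemeasurable (aemeasurable_symm e _) hA,
    withDensity_apply', Measure.restrict_restrict' e.open_target.measurableSet, Set.inter_comm]

lemma chartVolume_inter_source (e : Chart) {A : Set M} (hA : MeasurableSet A) :
    chartVolume g e A = chartVolume g e (A ∩ e.source) := by
  rw [chartVolume_apply g e hA, chartVolume_apply g e (hA.inter e.open_source.measurableSet)]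
  congr 2
  ext y
  simp only [Set.mem_inter_iff, Set.mem_preimage]
  exact ⟨fun h => ⟨h.1, h.2, e.map_target h.1⟩, fun h => ⟨h.1, h.2.1⟩⟩

/-- The local Riemannian volumes agree on the overlaps of charts. -/
lemma chartVolume_eq_of_subset {e c : Chart} (he : e ∈ IsManifold.maximalAtlas (𝓡 n) ∞ M)
    (hc : c ∈ IsManifold.maximalAtlas (𝓡 n) ∞ M) {A : Set M} (hA : MeasurableSet A)
    (hAe : A ⊆ e.source) (hAc : A ⊆ c.source) : chartVolume g e A = chartVolume g c A := by
  rw [chartVolume_apply g e hA, chartVolume_apply g c hA]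
  set S := e.target ∩ e.symm ⁻¹' A with hS
  have hSm : MeasurableSet S := measurableSet_target_inter_preimage e hA
  have himg : c.target ∩ c.symm ⁻¹' A = (c ∘ e.symm) '' S := by
    ext z
    constructor
    · rintro ⟨hz, hzA⟩
      refine ⟨e (c.symm z), ⟨e.map_source (hAe hzA), ?_⟩, ?_⟩
      · rwa [Set.mem_preimage, e.left_inv (hAe hzA)]
      · rw [Function.comp_apply, e.left_inv (hAe hzA), c.right_inv hz]
    · rintro ⟨y, ⟨hy, hyA⟩, rfl⟩
      refine ⟨c.map_source (hAc hyA), ?_⟩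
      rw [Set.mem_preimage, Function.comp_apply, c.left_inv (hAc hyA)]
      exact hyA
  have hinj : Set.InjOn (c ∘ e.symm) S := by
    intro y hy z hz h
    exact e.symm.injOn hy.1 hz.1 (c.injOn (hAc hy.2) (hAc hz.2) h)
  rw [himg, lintegral_image_eq_lintegral_abs_det_fderiv_mul volume hSm
    (fun y hy => ((contDiffAt_transition he hc hy.1 (hAc hy.2)).differentiableAt
      (by simp)).hasFDerivAt.hasFDerivWithinAt) hinj]
  -- The densities match because `√det(AᵀGA) = |det A| √det G`.
  refine setLIntegral_congr_fun hSm fun y hy => ?_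
  rw [gram_transition g he hc hy.1 (hAc hy.2), ← ENNReal.ofReal_mul (abs_nonneg _), ← det_jac,
    Matrix.det_mul, Matrix.det_mul, Matrix.det_transpose]
  congr 1
  rw [← Real.sqrt_sq_eq_abs, ← Real.sqrt_mul (sq_nonneg _)]
  congr 1
  ring

/-- The Riemannian volume is `√(det g) dx¹ ⋯ dxⁿ` on the domain of every chart. -/
lemma riemannianVolume_restrict {c : Chart} (hc : c ∈ IsManifold.maximalAtlas (𝓡 n) ∞ M) :
    (riemannianVolume g).restrict c.source = chartVolume g c := by
  have hcs := c.open_source.measurableSet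
  apply le_antisymm
  · have hle : riemannianVolume g ≤
        chartVolume g c + (⊤ : ENNReal) • Measure.count.restrict c.sourceᶜ := by
      refine iSup₂_le fun e he => ?_
      rw [Measure.le_iff]
      intro A hA
      rw [← measure_inter_add_sdiff A hcs, Measure.add_apply]
      refine add_le_add ?_ ?_
      · have hAc := hA.inter hcs
        rw [chartVolume_inter_source g e hAc, chartVolume_eq_of_subset g he hc
          (hAc.inter e.open_source.measurableSet) Set.inter_subset_right
          (Set.inter_subset_left.trans Set.inter_subset_right)]
        exact measure_mono (Set.inter_subset_left.trans Set.inter_subset_left)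
      · rw [Measure.smul_apply, Measure.restrict_apply hA, smul_eq_mul, ← Set.sdiff_eq]
        rcases (A \ c.source).eq_empty_or_nonempty with h | h
        · simp [h]
        · rw [ENNReal.top_mul (Measure.count_ne_zero h)]
          exact le_top
    refine (Measure.restrict_mono le_rfl hle).trans ?_
    rw [Measure.restrict_add, Measure.restrict_smul, Measure.restrict_restrict hcs]
    simp [Measure.restrict_le_self]
  · rw [Measure.le_iff]
    intro A hA
    rw [chartVolume_inter_source g c hA, Measure.restrict_apply hA]
    exact (le_iSup₂ (f := fun e (_ : e ∈ IsManifold.maximalAtlas (𝓡 n) ∞ M) =>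
      chartVolume g e) c hc) _

/-- Factoring `c.symm` through the subtype `c.target` makes it a measurable embedding, so the
formula needs no measurability of `f`. -/
lemma integral_chartVolume {c : Chart} (hc : c ∈ IsManifold.maximalAtlas (𝓡 n) ∞ M) (f : M → ℝ) :
    ∫ x, f x ∂(chartVolume g c) = ∫ y in c.target, √(gram g c y).det * f (c.symm y) := by
  set d : E → ENNReal := fun y => ENNReal.ofReal (√(gram g c y).det)
  set μ := (volume.restrict c.target).withDensity d with hμ
  have hval := MeasurableEmbedding.subtype_coe c.open_target.measurableSet
  have hμ' : Measure.map Subtype.val (Measure.comap (Subtype.val : c.target → E) μ) = μ := by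
    rw [hval.map_comap, Subtype.range_coe, hμ, restrict_withDensity c.open_target.measurableSet,
      Measure.restrict_restrict c.open_target.measurableSet, Set.inter_self]
  have hemb : MeasurableEmbedding (c.symm ∘ (Subtype.val : c.target → E)) :=
    (c.open_source.isOpenEmbedding_subtypeVal.comp
      c.toHomeomorphSourceTarget.symm.isOpenEmbedding).measurableEmbedding
  have hmap : chartVolume g c =
      Measure.map (c.symm ∘ (Subtype.val : c.target → E)) (Measure.comap Subtype.val μ) := by
    rw [← AEMeasurable.map_map_of_aemeasurable _ hval.measurable.aemeasurable, hμ']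
    · rfl
    · rw [hμ']; exact aemeasurable_symm c d
  have hcont : ContinuousOn d c.target := by
    have : ContinuousOn (fun y => (gram g c y).det) c.target := by
      simp only [Matrix.det_apply']
      exact continuousOn_finsetSum _ fun σ _ => continuousOn_const.mul
        (continuousOn_finsetProd _ fun i _ => (contDiffOn_gram g hc _ _).continuousOn)
    exact ENNReal.continuous_ofReal.comp_continuousOn (Real.continuous_sqrt.comp_continuousOn this)
  have h1 : ∫ x, f x ∂(chartVolume g c) = ∫ y, f (c.symm y) ∂μ := by
    rw [hmap, hemb.integral_map]
    conv_rhs => rw [← hμ', hval.integral_map]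
    rfl
  rw [h1, hμ, integral_withDensity_eq_integral_toReal_smul₀
    (hcont.aemeasurable c.open_target.measurableSet) (by simp [d])]
  simp only [d, ENNReal.toReal_ofReal (Real.sqrt_nonneg _), smul_eq_mul]

lemma integral_riemannianVolume {c : Chart} (hc : c ∈ IsManifold.maximalAtlas (𝓡 n) ∞ M)
    {f : M → ℝ} (hf : ∀ x ∉ c.source, f x = 0) :
    ∫ x, f x ∂(riemannianVolume g) =
      ∫ y in c.target, √(gram g c y).det * f (c.symm y) := by
  rw [← integral_chartVolume g hc, ← riemannianVolume_restrict g hc,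
    setIntegral_eq_integral_of_forall_compl_eq_zero hf]

end Volume

/-! ### Local integrability and uniqueness of weak derivatives -/

section LocallyIntegrable

variable {n : ℕ}

local notation "E" => EuclideanSpace ℝ (Fin n)

lemma locallyIntegrableOn_sum {κ : Type*} (s : Finset κ) {u : κ → E → ℝ} {U : Set E}
    (hu : ∀ a ∈ s, LocallyIntegrableOn (u a) U volume) :
    LocallyIntegrableOn (fun y => ∑ a ∈ s, u a y) U volume := by
  classical
  induction s using Finset.induction_on with
  | empty => simpa using locallyIntegrableOn_zero
  | insert a s ha ih =>
    simp only [Finset.sum_insert ha]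
    exact (hu a (Finset.mem_insert_self a s)).add
      (ih fun b hb => hu b (Finset.mem_insert_of_mem hb))

lemma integrable_mul_of_tsupport_subset {u χ : E → ℝ} {U : Set E}
    (hu : LocallyIntegrableOn u U volume) (hχ : Continuous χ) (hc : HasCompactSupport χ)
    (hU : tsupport χ ⊆ U) : Integrable (fun y => u y * χ y) volume := by
  have h1 : IntegrableOn (fun y => u y * χ y) (tsupport χ) volume :=
    (hu.integrableOn_compact_subset hU hc).mul_continuousOn hχ.continuousOn hc
  refine (integrableOn_iff_integrable_of_support_subset ?_).1 h1
  exact (Function.support_mul_subset_right u χ).trans (subset_tsupport χ)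

lemma integrableOn_mul_pderiv {u ψ : E → ℝ} {U : Set E} (hu : LocallyIntegrableOn u U volume)
    (hψ : ContDiff ℝ ∞ ψ) (hc : HasCompactSupport ψ) (hU : tsupport ψ ⊆ U) (i : Fin n) :
    IntegrableOn (fun y => u y * pderiv i ψ y) U volume :=
  (integrable_mul_of_tsupport_subset hu
    ((hψ.continuous_fderiv (by simp)).clm_apply continuous_const)
    (hc.fderiv_apply ℝ _) ((tsupport_fderiv_apply_subset ℝ _).trans hU)).integrableOn

/-- Weak partial derivatives are almost everywhere unique. -/
lemma IsWeakPartialDeriv.ae_eq {U : Set E} (hU : IsOpen U) {i : Fin n} {u w w' : E → ℝ}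
    (hw : IsWeakPartialDeriv U i u w) (hw' : IsWeakPartialDeriv U i u w') :
    ∀ᵐ y ∂(volume.restrict U), w y = w' y := by
  rw [ae_restrict_iff' hU.measurableSet]
  -- The fundamental lemma of the calculus of variations, applied to `w - w'`.
  have h := hU.ae_eq_zero_of_integral_contDiff_smul_eq_zero (μ := volume)
    (hw.locInt_deriv.sub hw'.locInt_deriv) fun ψ hψ hc hs => by
      have e1 : ∫ y, ψ y • (w - w') y = ∫ y in U, (w y * ψ y - w' y * ψ y) := by
        rw [← setIntegral_eq_integral_of_forall_compl_eq_zero (s := U)]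
        · refine integral_congr_ae (ae_of_all _ fun y => ?_)
          simp only [Pi.sub_apply, smul_eq_mul]; ring
        · intro y hy
          rw [image_eq_zero_of_notMem_tsupport fun h => hy (hs h), zero_smul]
      rw [e1, integral_sub
        (integrable_mul_of_tsupport_subset hw.locInt_deriv hψ.continuous hc hs).integrableOn
        (integrable_mul_of_tsupport_subset hw'.locInt_deriv hψ.continuous hc hs).integrableOn,
        hw.integral_eq ψ hψ hc hs, hw'.integral_eq ψ hψ hc hs, sub_self]
  filter_upwards [h] with y hy hyU
  exact sub_eq_zero.1 (hy hyU)

end LocallyIntegrable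

/-! ### The adjoint depends only on the germ of the tensor -/

section Locality

variable {n k : ℕ}

local notation "E" => EuclideanSpace ℝ (Fin n)

lemma covAdjointOf_congr (G : E → Matrix (Fin n) (Fin n) ℝ) {t t' : (Fin (k + 1) → Fin n) → E → ℝ}
    {y : E} (h : ∀ P, t P =ᶠ[nhds y] t' P) (J : Fin k → Fin n) :
    covAdjointOf G t J y = covAdjointOf G t' J y := by
  simp only [covAdjointOf, covDerivOf, pderiv_congr (h _), (h _).eq_of_nhds]

lemma covAdjointOf_zero (G : E → Matrix (Fin n) (Fin n) ℝ) (J : Fin k → Fin n) (y : E) :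
    covAdjointOf G (fun _ _ => 0) J y = 0 := by
  simp [covAdjointOf, covDerivOf, pderiv]

end Locality

/-! ### The global test tensor and the weak identity in a chart -/

section WeakDerivative

variable {n k : ℕ} {M : Type*} [TopologicalSpace M]
  [ChartedSpace (EuclideanSpace ℝ (Fin n)) M] [IsManifold (𝓡 n) ∞ M] (g : Metric n M)

local notation "E" => EuclideanSpace ℝ (Fin n)
local notation "Chart" => OpenPartialHomeomorph M (EuclideanSpace ℝ (Fin n))

/-- The coefficients in the chart `c` of the tensor whose inner product with a tensor `T`, times
the volume density, is `T_P ψ`. -/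
def testCoeff (c : Chart) (P : Fin k → Fin n) (ψ : E → ℝ) (Q : Fin k → Fin n) (y : E) : ℝ :=
  (ψ y / √(gram g c y).det) * kronPow k (gram g c y) Q P

open Classical in
/-- The tensor field with coefficients `testCoeff`, extended by zero. -/
def testTensor (c : Chart) (P : Fin k → Fin n) (ψ : E → ℝ) : TensorField n M k := fun x =>
  if x ∈ c.source then tensorOfCoeffs c x fun Q => testCoeff g c P ψ Q (c x) else 0

variable {g} {c : OpenPartialHomeomorph M (EuclideanSpace ℝ (Fin n))} {P : Fin k → Fin n}
  {ψ : EuclideanSpace ℝ (Fin n) → ℝ}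

lemma testTensor_eq_zero {x : M} (hx : x ∉ c.symm '' tsupport ψ) : testTensor g c P ψ x = 0 := by
  by_cases hxc : x ∈ c.source
  · have hψ : ψ (c x) = 0 :=
      image_eq_zero_of_notMem_tsupport fun h => hx ⟨c x, h, c.left_inv hxc⟩
    simp [testTensor, hxc, tensorOfCoeffs, testCoeff, hψ]
  · simp [testTensor, hxc]

lemma coeff_testTensor (hc : c ∈ IsManifold.maximalAtlas (𝓡 n) ∞ M) {e : Chart}
    (he : e ∈ IsManifold.maximalAtlas (𝓡 n) ∞ M) {y : E} (hy : y ∈ e.target)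
    (hyc : e.symm y ∈ c.source) (J : Fin k → Fin n) :
    coeff e (testTensor g c P ψ) J y =
      ∑ Q, kronPow k (jac (c ∘ e.symm) y) Q J * testCoeff g c P ψ Q ((c ∘ e.symm) y) := by
  have h : testTensor g c P ψ (e.symm y) =
      tensorOfCoeffs c (e.symm y) fun Q => testCoeff g c P ψ Q (c (e.symm y)) := if_pos hyc
  rw [coeff, h, coeff_tensorOfCoeffs he hc hy hyc]
  rfl

lemma coeff_testTensor_self (hc : c ∈ IsManifold.maximalAtlas (𝓡 n) ∞ M) {y : E}
    (hy : y ∈ c.target) (J : Fin k → Fin n) :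
    coeff c (testTensor g c P ψ) J y = testCoeff g c P ψ J y := by
  rw [coeff_testTensor hc hc hy (c.map_target hy), jac_self hy, kronPow_one,
    Function.comp_apply, c.right_inv hy]
  simp [Matrix.one_apply]

lemma contDiffAt_det {B : E → Matrix (Fin n) (Fin n) ℝ} {y : E}
    (hB : ∀ i j, ContDiffAt ℝ ∞ (fun z => B z i j) y) : ContDiffAt ℝ ∞ (fun z => (B z).det) y := by
  simp only [Matrix.det_apply']
  exact ContDiffAt.sum fun σ _ => contDiffAt_const.mul (contDiffAt_prod fun i _ => hB _ _)

lemma contDiffAt_kronPow {B : E → Matrix (Fin n) (Fin n) ℝ} {y : E}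
    (hB : ∀ i j, ContDiffAt ℝ ∞ (fun z => B z i j) y) (I J : Fin k → Fin n) :
    ContDiffAt ℝ ∞ (fun z => kronPow k (B z) I J) y :=
  contDiffAt_prod (t := Finset.univ) (f := fun m z => B z (I m) (J m)) fun _ _ => hB _ _

lemma contDiffAt_testCoeff (hc : c ∈ IsManifold.maximalAtlas (𝓡 n) ∞ M) (hψ : ContDiff ℝ ∞ ψ)
    {y : E} (hy : y ∈ c.target) (Q : Fin k → Fin n) :
    ContDiffAt ℝ ∞ (testCoeff g c P ψ Q) y := by
  have hg : ∀ i j, ContDiffAt ℝ ∞ (fun z => gram g c z i j) y :=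
    fun i j => (contDiffOn_gram g hc i j).contDiffAt (c.open_target.mem_nhds hy)
  have hpos := gram_det_pos g hc hy
  exact (hψ.contDiffAt.div ((contDiffAt_det hg).sqrt hpos.ne') (Real.sqrt_pos.2 hpos).ne').mul
    (contDiffAt_kronPow hg Q P)

/-- The image of the support in `M` is compact, hence closed because `M` is Hausdorff, so its
complement is an open set on which the tensor vanishes. -/
lemma eventually_testTensor_eq_zero [T2Space M] (hs : HasCompactSupport ψ)
    (hU : tsupport ψ ⊆ c.target) {e : Chart} {y : E} (hy : y ∈ e.target)
    (hyc : e.symm y ∉ c.symm '' tsupport ψ) (J : Fin k → Fin n) :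
    coeff e (testTensor g c P ψ) J =ᶠ[nhds y] fun _ => 0 := by
  have ho := (isCompact_image_tsupport hs hU).isClosed.isOpen_compl
  filter_upwards [(e.continuousAt_symm hy).preimage_mem_nhds (ho.mem_nhds hyc)] with z hz
  exact coeff_eq_zero (testTensor_eq_zero hz) J

/-- `c.source` and the complement of the compact image of the support form an open cover of `M`: the
transformation law gives smoothness on the first, vanishing on the second. -/
lemma smooth_testTensor [T2Space M] (hc : c ∈ IsManifold.maximalAtlas (𝓡 n) ∞ M)
    (hψ : ContDiff ℝ ∞ ψ) (hs : HasCompactSupport ψ) (hU : tsupport ψ ⊆ c.target) :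
    Smooth (testTensor g c P ψ) := by
  intro e he J y hy
  apply ContDiffAt.contDiffWithinAt
  by_cases hyc : e.symm y ∈ c.source
  · have hev : coeff e (testTensor g c P ψ) J =ᶠ[nhds y] fun z =>
        ∑ Q, kronPow k (jac (c ∘ e.symm) z) Q J * testCoeff g c P ψ Q ((c ∘ e.symm) z) := by
      filter_upwards [eventually_mem_target hy hyc] with z hz
      exact coeff_testTensor hc he hz.1 hz.2 J
    refine ContDiffAt.congr_of_eventuallyEq ?_ hev
    have hF := contDiffAt_transition he hc hy hyc
    exact ContDiffAt.sum fun Q _ => (contDiffAt_kronPow (contDiffAt_jac hF) Q J).mul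
      (ContDiffAt.comp (g := testCoeff g c P ψ Q) y
        (contDiffAt_testCoeff hc hψ (c.map_source hyc) Q) hF)
  · refine contDiffAt_const.congr_of_eventuallyEq
      (eventually_testTensor_eq_zero hs hU hy (fun h => hyc ?_) J)
    obtain ⟨z, hz, hzy⟩ := h
    exact hzy ▸ c.map_target (hU hz)

lemma compactlySupported_testTensor [T2Space M] (hs : HasCompactSupport ψ)
    (hU : tsupport ψ ⊆ c.target) : CompactlySupported (testTensor g c P ψ) := by
  have hK := isCompact_image_tsupport hs hU
  refine hK.of_isClosed_subset isClosed_closure (closure_minimal (fun x hx => ?_) hK.isClosed)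
  by_contra h
  exact hx (testTensor_eq_zero h)

lemma tensorInner_testTensor_eq_zero (τ : TensorField n M k) {x : M} (hx : x ∉ c.source) :
    tensorInner g τ (testTensor g c P ψ) x = 0 := by
  have h : ∀ J, coeff (chartAt E x) (testTensor g c P ψ) J (chartAt E x x) = 0 := by
    intro J
    refine coeff_eq_zero ?_ J
    rw [(chartAt E x).left_inv (mem_chart_source E x)]
    exact if_neg hx
  simp [tensorInner, tensorInnerCoord, h]

lemma tensorInner_covAdjoint_testTensor_eq_zero [T2Space M] {P : Fin (k + 1) → Fin n}
    (hc : c ∈ IsManifold.maximalAtlas (𝓡 n) ∞ M)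
    (hψ : ContDiff ℝ ∞ ψ) (hs : HasCompactSupport ψ) (hU : tsupport ψ ⊆ c.target)
    (α : TensorField n M k) {x : M} (hx : x ∉ c.source) :
    tensorInner g α (covAdjoint g (testTensor g c P ψ)) x = 0 := by
  have hxe := mem_chart_source E x
  have h : ∀ J, coeff (chartAt E x) (covAdjoint g (testTensor g c P ψ)) J (chartAt E x x) = 0 := by
    intro J
    rw [coeff_covAdjoint g (smooth_testTensor hc hψ hs hU) (IsManifold.chart_mem_maximalAtlas x)
      ((chartAt E x).map_source hxe), ← covAdjointOf_zero (gram g (chartAt E x)) J]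
    refine covAdjointOf_congr _ (fun Q => eventually_testTensor_eq_zero hs hU
      ((chartAt E x).map_source hxe) ?_ Q) J
    rw [(chartAt E x).left_inv hxe]
    rintro ⟨z, hz, rfl⟩
    exact hx (c.map_target (hU hz))
  simp [tensorInner, tensorInnerCoord, h]

lemma density_mul_tensorInner_testTensor (hc : c ∈ IsManifold.maximalAtlas (𝓡 n) ∞ M)
    (τ : TensorField n M k) {y : E} (hy : y ∈ c.target) :
    √(gram g c y).det * tensorInner g τ (testTensor g c P ψ) (c.symm y) = coeff c τ P y * ψ y := by
  have hpos := gram_det_pos g hc hy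
  have hsq := (Real.sqrt_pos.2 hpos).ne'
  rw [tensorInner_eq g hc hy, tensorInnerCoord, ← sum_kronPow_inv_mul hpos.ne'.isUnit
    (fun I => coeff c τ I y) P]
  simp only [coeff_testTensor_self hc hy, testCoeff, Finset.mul_sum, Finset.sum_mul]
  refine Finset.sum_congr rfl fun I _ => Finset.sum_congr rfl fun J _ => ?_
  rw [kronPow_apply (gram g c y)⁻¹]
  field_simp

lemma density_mul_tensorInner_covAdjoint_testTensor [T2Space M]
    (hc : c ∈ IsManifold.maximalAtlas (𝓡 n) ∞ M)
    (hψ : ContDiff ℝ ∞ ψ) (hs : HasCompactSupport ψ) (hU : tsupport ψ ⊆ c.target)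
    (α : TensorField n M k) (i : Fin n) (J : Fin k → Fin n) {y : E} (hy : y ∈ c.target) :
    √(gram g c y).det *
        tensorInner g α (covAdjoint g (testTensor g c (Fin.cons i J) ψ)) (c.symm y) =
      -(coeff c α J y * pderiv i ψ y + (∑ μ, ∑ l, christoffel g c l i (J μ) y *
        coeff c α (Function.update J μ l) y) * ψ y) := by
  have hev : ∀ Q, coeff c (testTensor g c (Fin.cons i J) ψ) Q =ᶠ[nhds y]
      testCoeff g c (Fin.cons i J : Fin (k + 1) → Fin n) ψ Q := by
    intro Q
    filter_upwards [c.open_target.mem_nhds hy] with z hz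
    exact coeff_testTensor_self hc hz Q
  have hdet : ∀ᶠ z in nhds y, 0 < (gram g c z).det :=
    Filter.mem_of_superset (c.open_target.mem_nhds hy) fun z hz => gram_det_pos g hc hz
  rw [tensorInner_eq g hc hy, tensorInnerCoord]
  simp only [coeff_covAdjoint g (smooth_testTensor hc hψ hs hU) hc hy,
    covAdjointOf_congr (gram g c) hev]
  exact inner_covAdjointOf_kronPow (gram_isSymm g c) (differentiableAt_gram g hc hy) hdet
    (hψ.differentiable (by simp) y) (fun I => coeff c α I y) i J

lemma continuousOn_christoffel (hc : c ∈ IsManifold.maximalAtlas (𝓡 n) ∞ M) (l i j : Fin n) :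
    ContinuousOn (christoffel g c l i j) c.target := by
  have hcont : ContinuousOn (gram g c) c.target :=
    continuousOn_pi.2 fun a => continuousOn_pi.2 fun b => (contDiffOn_gram g hc a b).continuousOn
  have hinv : ∀ a b, ContinuousOn (fun y => (gram g c y)⁻¹ a b) c.target := by
    intro a b
    have h1 : ContinuousOn (fun y => (gram g c y).det) c.target :=
      (continuous_id.matrix_det).comp_continuousOn hcont
    have h2 : ContinuousOn (fun y => (gram g c y).adjugate a b) c.target :=
      ((continuous_id.matrix_adjugate).matrix_elem a b).comp_continuousOn hcont
    refine ((h1.inv₀ fun y hy => (gram_det_pos g hc hy).ne').mul h2).congr fun y _ => ?_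
    simp [Matrix.inv_def, Ring.inverse_eq_inv']
  have hder : ∀ m a b, ContinuousOn (fun y => pderiv m (fun z => gram g c z a b) y) c.target :=
    fun m a b => ((contDiffOn_gram g hc a b).continuousOn_fderiv_of_isOpen c.open_target
      (by simp)).clm_apply continuousOn_const
  exact continuousOn_const.mul (continuousOn_finsetSum _ fun m _ =>
    (hinv l m).mul (((hder i j m).add (hder j i m)).sub (hder m i j)))

/-- A weak covariant derivative determines the weak partial derivatives of the coefficients. -/
lemma IsWeakCovDeriv.isWeakPartialDeriv [T2Space M] [MeasurableSpace M] [BorelSpace M]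
    {α : Form n M k} {τ : TensorField n M (k + 1)} (hτ : IsWeakCovDeriv g α τ)
    (hc : c ∈ IsManifold.maximalAtlas (𝓡 n) ∞ M) (i : Fin n) (J : Fin k → Fin n) :
    IsWeakPartialDeriv c.target i (coeff c α.toTensor J) fun y =>
      coeff c τ (Fin.cons i J) y + ∑ μ, ∑ l, christoffel g c l i (J μ) y *
        coeff c α.toTensor (Function.update J μ l) y := by
  have hα := hτ.locInt_form c hc
  have hτc := hτ.locInt_deriv c hc (Fin.cons i J)
  -- The Christoffel symbols are continuous on the chart image, so multiplying by them preserves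
  -- local integrability.
  have hΓ : LocallyIntegrableOn (fun y => ∑ μ, ∑ l, christoffel g c l i (J μ) y *
      coeff c α.toTensor (Function.update J μ l) y) c.target volume :=
    locallyIntegrableOn_sum _ fun μ _ => locallyIntegrableOn_sum _ fun l _ =>
      (hα _).continuousOn_mul (continuousOn_christoffel hc l i (J μ))
        c.open_target.isLocallyClosed
  refine ⟨hα J, hτc.add hΓ, fun ψ hψ hs hU => ?_⟩
  have key := hτ.integral_eq (testTensor g c (Fin.cons i J) ψ) (smooth_testTensor hc hψ hs hU)
    (compactlySupported_testTensor hs hU)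
  rw [integral_riemannianVolume g hc fun x hx => tensorInner_testTensor_eq_zero τ hx,
    integral_riemannianVolume g hc fun x hx =>
      tensorInner_covAdjoint_testTensor_eq_zero hc hψ hs hU α.toTensor hx,
    setIntegral_congr_fun c.open_target.measurableSet
      fun y hy => density_mul_tensorInner_testTensor hc τ hy,
    setIntegral_congr_fun c.open_target.measurableSet
      fun y hy => density_mul_tensorInner_covAdjoint_testTensor hc hψ hs hU α.toTensor i J hy,
    integral_neg, integral_add (integrableOn_mul_pderiv (hα J) hψ hs hU i)
      (integrable_mul_of_tsupport_subset hΓ hψ.continuous hs hU).integrableOn] at key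
  simp only [add_mul]
  rw [integral_add (integrable_mul_of_tsupport_subset hτc hψ.continuous hs hU).integrableOn
    (integrable_mul_of_tsupport_subset hΓ hψ.continuous hs hU).integrableOn, key]
  ring

end WeakDerivative

end WeakCov

end

/-! ### The coordinate formula for an arbitrary choice of weak derivative -/

theorem corollary1p2 {n : ℕ} {M : Type*} [TopologicalSpace M] [T2Space M]
    [SecondCountableTopology M] [MeasurableSpace M] [BorelSpace M]
    [ChartedSpace (EuclideanSpace ℝ (Fin n)) M] [IsManifold (𝓡 n) ∞ M]
    (g : WeakCov.Metric n M) {q : ℕ} (hq : 1 ≤ q)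
    (α : WeakCov.Form n M q) (τ : WeakCov.TensorField n M (q + 1))
    (hτ : WeakCov.IsWeakCovDeriv g α τ)
    (φ : OpenPartialHomeomorph M (EuclideanSpace ℝ (Fin n)))
    (hφ : φ ∈ IsManifold.maximalAtlas (𝓡 n) ∞ M)
    (i : Fin n) (J : Fin q → Fin n) :
    (∃ w : EuclideanSpace ℝ (Fin n) → ℝ,
      WeakCov.IsWeakPartialDeriv φ.target i (WeakCov.coeff φ α.toTensor J) w) ∧
    ∀ w : EuclideanSpace ℝ (Fin n) → ℝ,
      WeakCov.IsWeakPartialDeriv φ.target i (WeakCov.coeff φ α.toTensor J) w →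
      ∀ᵐ y ∂(volume.restrict φ.target),
        WeakCov.coeff φ τ (Fin.cons i J) y =
          w y - ∑ μ : Fin q, ∑ l : Fin n,
            WeakCov.christoffel g φ l i (J μ) y *
              WeakCov.coeff φ α.toTensor (Function.update J μ l) y := by
  have h := hτ.isWeakPartialDeriv hφ i J
  refine ⟨⟨_, h⟩, fun w hw => ?_⟩
  filter_upwards [hw.ae_eq φ.open_target h] with y hy
  rw [hy, add_sub_cancel_right]
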